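/- Let $d\ge 1$, let $n_1,\dots,n_d\ge 1$ and $k_1,\dots,k_d\ge 0$ be integers, and put $m_i=n_i+k_i$. Let $\Omega=\prod_{i=1}^d\{a_i,\dots,a_i+n_i-1\}$ with $0\le a_i\le k_i$, a box of size $n_1\times\cdots\times n_d$ inside the index set $\prod_{i=1}^d\{0,\dots,m_i-1\}$. For $\mathbf X\in\mathbb R^{n_1\times\cdots\times n_d}$ (indexed by $\Omega$) and $\mathbf Y\in\mathbb R^{m_1\times\cdots\times m_d}$ let $\mathbf Z(\mathbf X,\mathbf Y)\in\mathbb R^{m_1\times\cdots\times m_d}$ be the array which equals $\mathbf X$ on $\Omega$ and $\mathbf Y$ off $\Omega$, and let $\mathcal F$ be the $d$-dimensional discrete Fourier transform of size $m_1\times\cdots\times m_d$. Given a known background $\mathbf Y$ and data $\mathbf I\in\mathbb R^{m_1\times\cdots\times m_d}$, consider the problem $$\text{find }\mathbf Z\in\mathbb R^{m_1\times\cdots\times m_d}\quad\text{such that}\quad |\mathcal F(\mathbf Z)|^2=\mathbf I\ \text{ entrywise, and }\ \mathbf Z=\mathbf Z(\mathbf X,\mathbf Y)\ \text{ for some }\mathbf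 X\in\mathbb R^{n_1\times\cdots\times n_d}.\qquad(\ast)$$ Let the entries of $\mathbf Y$ off $\Omega$ be i.i.d. with law $\mathcal N(\mu,\sigma^2)$, where $\mu\in\mathbb R$ and $\sigma>0$, and let $\mathbf Y=0$ on $\Omega$. If $$\prod_{i=1}^d(n_i+k_i)\ \ge\ 2\prod_{i=1}^d n_i+\prod_{i=1}^d(2n_i-1),$$ then almost surely (in $\mathbf Y$) the solution of $(\ast)$ is unique: for every $\mathbf X_0\in\mathbb R^{n_1\times\cdots\times n_d}$, the problem $(\ast)$ with data $\mathbf I=|\mathcal F(\mathbf Z(\mathbf X_0,\mathbf Y))|^2$ has exactly one solution, with no ambiguity left. In particular, if $n_i=n$ and $k_i=k$ for all $i$, then $k\ge\bigl(2^{\frac{d+1}{d}}-1\bigr)n$ suffices for the same conclusion. -/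

import Mathlib

open MeasureTheory ProbabilityTheory
open scoped NNReal

namespace BackgroundPR

/-- Indices of a `d`-dimensional array of size `m 0 × ⋯ × m (d-1)`. -/
abbrev Idx {d : ℕ} (m : Fin d → ℕ) : Type := (i : Fin d) → Fin (m i)

/-- The sample region `Ω`: the box of side lengths `n` whose lowest corner is `a`,
inside an array of size `m`. -/
def region {d : ℕ} (m n a : Fin d → ℕ) : Set (Idx m) :=
  {j | ∀ i, a i ≤ (j i : ℕ) ∧ (j i : ℕ) < a i + n i}

open Classical in
/-- The combined array `Z`: the sample `X` on the region `Ω`, the background `Y` elsewhere. -/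
noncomputable def combine {d : ℕ} (m n a : Fin d → ℕ) (X : Idx n → ℝ) (Y : Idx m → ℝ) :
    Idx m → ℝ := fun j =>
  if h : j ∈ region m n a then
    X fun i => ⟨(j i : ℕ) - a i, Nat.sub_lt_left_of_lt_add (h i).1 (h i).2⟩
  else Y j

/-- The `d`-dimensional discrete Fourier transform of a real array. -/
noncomputable def dft {d : ℕ} (m : Fin d → ℕ) (Z : Idx m → ℝ) : Idx m → ℂ := fun l =>
  ∑ j : Idx m, (Z j : ℂ) *
    Complex.exp (-2 * Real.pi * Complex.I * ∑ i, ((j i : ℕ) : ℂ) * ((l i : ℕ) : ℂ) / (m i : ℂ))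

/-- The phaseless measurements `I = |𝓕(Z)|²`, entrywise. -/
noncomputable def intensity {d : ℕ} (m : Fin d → ℕ) (Z : Idx m → ℝ) : Idx m → ℝ := fun l =>
  ‖dft m Z l‖ ^ 2

/-- `Z` solves the phase retrieval problem with data `I` and known background `Y`: it has
intensity `I` and it agrees with `Y` outside `Ω`, the sample on `Ω` being unknown. -/
def IsSolution {d : ℕ} (m n a : Fin d → ℕ) (I Y Z : Idx m → ℝ) : Prop :=
  intensity m Z = I ∧ ∃ X : Idx n → ℝ, Z = combine m n a X Y

/-- `Y` is a random background on the probability space `(W, P)`: zero on `Ω`, with independent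
entries of law `𝒩(μ, σ²)` off `Ω`. -/
structure IsGaussianBackground {d : ℕ} (m n a : Fin d → ℕ) {W : Type*} [MeasurableSpace W]
    (P : Measure W) (μ : ℝ) (σ : ℝ≥0) (Y : W → Idx m → ℝ) : Prop where
  zero_on : ∀ j ∈ region m n a, ∀ w, Y w j = 0
  law_off : ∀ j ∉ region m n a, HasLaw (fun w => Y w j) (gaussianReal μ (σ ^ 2)) P
  indep_off : iIndepFun (fun (j : {j : Idx m // j ∉ region m n a}) (w : W) => Y w j.1) P

/-- Almost surely in the background, every sample `X` is such that the problem whose data are the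
intensities produced by `X` has exactly one solution. -/
def AlmostSurelyUnique {d : ℕ} (m n a : Fin d → ℕ) {W : Type*} [MeasurableSpace W]
    (P : Measure W) (Y : W → Idx m → ℝ) : Prop :=
  ∀ᵐ w ∂P, ∀ X : Idx n → ℝ,
    ∃! Z : Idx m → ℝ, IsSolution m n a (intensity m (combine m n a X (Y w))) (Y w) Z

end BackgroundPR

/-! Equal intensities mean equal cyclic autocorrelations. Let Z, Z' be two solutions; D = Z' - Z is
supported on Ω. If the shift s moves Ω off itself in both directions, then in the difference of the
autocorrelations at s only background values of Z + Z' = 2Y meet D, and the quadratic condition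
becomes linear: ∑ D(p)(Y(p+s) + Y(p-s)) = 0. The shifts s and -s give the same equation and at most
∏(2nᵢ-1) shifts are lost, so the hypothesis provides at least as many equations as unknowns.

Injectivity of this system holds off the zero set of a polynomial in the entries off Ω, which
independent Gaussians avoid almost surely once it is nonzero (`exists_polynomial_of_background`,
`ae_eval_ne_zero`). Hence one good complex background suffices (`exists_background_box`).

If 2nᵢ-1 ≤ mᵢ in every direction, `exists_orientation` picks from each pair ±s with s ≠ -s a sign
making Y(j+s) the larger variable for every j in Ω. These leading variables are distinct along rows
and columns, and letting them dominate one after another gives independent columns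
(`exists_labelled_injective`).

Directions in which the box wraps around go into a separate factor A. A background acts on D as a
sum of rank-one maps indexed by characters, and by linear matroid intersection
(`exists_rankOneFamily_injective`) suitable coefficients exist once certain dimension inequalities
hold. It is enough to verify them for a square array of backgrounds acting on several samples
(`exists_background_of_array`). The freedom in the array decouples the frequencies of A into blocks
(`exists_background_array`), each settled by leading variables (`exists_frequency_block`). -/

namespace BackgroundPR

/-! ### Pencils of linear maps and linear matroid intersection -/

section Rado

variable {K U V W F X ι : Type*} [Field K] [AddCommGroup U] [Module K U] [AddCommGroup V]
  [Module K V] [AddCommGroup W] [Module K W] [AddCommGroup F] [Module K F]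

/-- A pencil of linear maps through an injective one has finitely many non-injective members. -/
theorem finite_not_injective_pencil [FiniteDimensional K U] (L₁ L₂ : U →ₗ[K] F)
    (h : Function.Injective L₁) : {t : K | ¬ Function.Injective (L₁ + t • L₂)}.Finite := by
  obtain ⟨g, hg⟩ := L₁.exists_leftInverse_of_injective (LinearMap.ker_eq_bot.2 h)
  have hg' : ∀ x, g (L₁ x) = x := fun x => LinearMap.congr_fun hg x
  -- With `g` a left inverse of `L₁`, a kernel vector at t is an eigenvector of g ∘ L₂ with
  -- eigenvalue -t⁻¹.
  refine ((Module.End.finite_hasEigenvalue (g ∘ₗ L₂)).image fun μ => -μ⁻¹).subset ?_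
  intro t ht
  rw [Set.mem_ofPred_eq, injective_iff_map_eq_zero] at ht
  push Not at ht
  obtain ⟨D, hD, hD0⟩ := ht
  have h1 : D + t • g (L₂ D) = 0 := by
    have := congrArg g hD
    simpa [hg'] using this
  have ht0 : t ≠ 0 := by
    rintro rfl
    simp at h1
    exact hD0 h1
  refine ⟨-t⁻¹, ?_, by simp⟩
  refine Module.End.hasEigenvalue_of_hasEigenvector (x := D) ⟨?_, hD0⟩
  rw [Module.End.mem_eigenspace_iff]
  have h2 : t • g (L₂ D) = -D := by rw [eq_neg_iff_add_eq_zero, add_comm, h1]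
  calc g (L₂ D) = t⁻¹ • (t • g (L₂ D)) := by rw [smul_smul, inv_mul_cancel₀ ht0, one_smul]
    _ = -t⁻¹ • D := by rw [h2, smul_neg, neg_smul]

/-- In a linear family of maps, finitely many injectivity requirements on subspaces which can be
met one at a time can be met simultaneously. -/
theorem exists_forall_injOn [Infinite K] [FiniteDimensional K W] (A : V →ₗ[K] (W →ₗ[K] F))
    (s : Finset ι) (S : ι → Submodule K W)
    (h : ∀ i ∈ s, ∃ y, ∀ D ∈ S i, A y D = 0 → D = 0) :
    ∃ y, ∀ i ∈ s, ∀ D ∈ S i, A y D = 0 → D = 0 := by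
  classical
  have key : ∀ (y y' : V) (T : Submodule K W), (∀ D ∈ T, A y D = 0 → D = 0) →
      {t : K | ¬ ∀ D ∈ T, A (y + t • y') D = 0 → D = 0}.Finite := by
    intro y y' T hT
    refine (finite_not_injective_pencil ((A y).domRestrict T) ((A y').domRestrict T)
      ?_).subset ?_
    · rw [injective_iff_map_eq_zero]
      rintro ⟨D, hD⟩ h0
      exact Subtype.ext (hT D hD h0)
    · intro t ht hinj
      refine ht fun D hD h0 => ?_
      rw [injective_iff_map_eq_zero] at hinj
      have := hinj ⟨D, hD⟩ (by simpa using h0)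
      simpa using this
  induction s using Finset.induction_on with
  | empty => exact ⟨0, by simp⟩
  | insert a s ha ih =>
    obtain ⟨y, hy⟩ := ih fun i hi => h i (Finset.mem_insert_of_mem hi)
    obtain ⟨y', hy'⟩ := h a (Finset.mem_insert_self a s)
    have f1 : (⋃ i ∈ s, {t : K | ¬ ∀ D ∈ S i, A (y + t • y') D = 0 → D = 0}).Finite :=
      s.finite_toSet.biUnion fun i hi => key y y' _ (hy i hi)
    -- y + t • y' is proportional to y' + t⁻¹ • y, so the pencil based at y' also excludes only
    -- finitely many t.
    have f2 := ((key y' y _ hy').image fun t => t⁻¹)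
    obtain ⟨t, ht⟩ := ((f1.union f2).union (Set.finite_singleton (0 : K))).exists_notMem
    simp only [Set.mem_union, not_or] at ht
    obtain ⟨⟨h1, h2⟩, h3⟩ := ht
    have h3 : t ≠ 0 := h3
    refine ⟨y + t • y', fun i hi => ?_⟩
    rcases Finset.mem_insert.1 hi with rfl | hi
    · by_contra hc
      refine h2 ⟨t⁻¹, ?_, inv_inv t⟩
      intro hall
      refine hc fun D hD h0 => hall D hD ?_
      have : y' + t⁻¹ • y = t⁻¹ • (y + t • y') := by
        rw [smul_add, smul_smul, inv_mul_cancel₀ h3, one_smul, add_comm]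
      rw [this, map_smul, LinearMap.smul_apply, h0, smul_zero]
    · by_contra hc
      exact h1 (Set.mem_biUnion hi hc)

/-- The subspace on which all functionals indexed outside `Q` vanish. -/
def spectralSubspace (φ : X → W →ₗ[K] K) (Q : Finset X) : Submodule K W where
  carrier := {D | ∀ x ∉ Q, φ x D = 0}
  add_mem' := fun ha hb x hx => by simp [ha x hx, hb x hx]
  zero_mem' := fun x _ => map_zero _
  smul_mem' := fun c a ha x hx => by simp [ha x hx]

/-- The linear family `y ↦ ∑ x, y x • φ x (·) • f x` spanned by rank-one maps. -/
def rankOneFamily [Fintype X] (φ : X → W →ₗ[K] K) (f : X → F) : (X → K) →ₗ[K] (W →ₗ[K] F) where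
  toFun y := ∑ x, y x • (φ x).smulRight (f x)
  map_add' y z := by simp [add_smul, Finset.sum_add_distrib]
  map_smul' c y := by simp [mul_smul, Finset.smul_sum]

theorem rankOneFamily_apply [Fintype X] (φ : X → W →ₗ[K] K) (f : X → F) (y : X → K) (D : W) :
    rankOneFamily φ f y D = ∑ x, (y x * φ x D) • f x := by
  simp [rankOneFamily, LinearMap.sum_apply, mul_smul]

/-- Linear matroid intersection: a family of rank-one maps contains an injective member in its
span as soon as no subset of the index set obstructs this by its dimensions. -/
theorem exists_rankOneFamily_injective [Infinite K] [Fintype X] [FiniteDimensional K W]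
    (φ : X → W →ₗ[K] K) (f : X → F)
    (h : ∀ Q : Finset X, Module.finrank K (spectralSubspace φ Q) ≤
      Module.finrank K (Submodule.span K (f '' (Q : Set X)))) :
    ∃ y, Function.Injective (rankOneFamily φ f y) := by
  classical
  set A := rankOneFamily φ f with hA
  suffices H : ∀ Q : Finset X, ∃ y, ∀ D ∈ spectralSubspace φ Q, A y D = 0 → D = 0 by
    obtain ⟨y, hy⟩ := H Finset.univ
    refine ⟨y, (injective_iff_map_eq_zero _).2 fun D hD => hy D ?_ hD⟩
    intro x hx
    simp at hx
  intro Q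
  induction Q using Finset.strongInduction with
  | H Q ih =>
  set T := spectralSubspace φ Q with hT
  -- A generic `y` is wanted: of minimal kernel on `T`, and injective on the subspace of every
  -- proper subset of `Q`.
  obtain ⟨y₀, hy₀⟩ : ∃ y₀, ∀ y, Module.finrank K ↥(T ⊓ LinearMap.ker (A y₀)) ≤
      Module.finrank K ↥(T ⊓ LinearMap.ker (A y)) := by
    have := exists_minimal_of_wellFoundedLT (fun n : ℕ => ∃ y,
      n = Module.finrank K ↥(T ⊓ LinearMap.ker (A y))) ⟨_, 0, rfl⟩
    obtain ⟨n, ⟨y, rfl⟩, hn⟩ := this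
    refine ⟨y, fun y' => ?_⟩
    by_contra hc
    push Not at hc
    exact absurd (hn ⟨y', rfl⟩ hc.le) (not_le.2 hc)
  -- Injectivity on a complement of the minimal kernel forces the rank on `T` to be maximal, which
  -- turns minimality into an injectivity requirement like the others.
  obtain ⟨C, hC⟩ := Submodule.exists_isCompl ((T ⊓ LinearMap.ker (A y₀)).comap T.subtype)
  set C' : Submodule K W := C.map T.subtype with hC'
  obtain ⟨y, hy⟩ := exists_forall_injOn A (ι := Option (Finset X))
    (insert none (Q.ssubsets.image some))
    (fun o => o.elim C' (spectralSubspace φ)) (by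
      intro o ho
      rcases o with _ | Q'
      · refine ⟨y₀, ?_⟩
        rintro D ⟨D', hD', rfl⟩ h0
        have : D' ∈ ((T ⊓ LinearMap.ker (A y₀)).comap T.subtype) ⊓ C :=
          ⟨⟨D'.2, h0⟩, hD'⟩
        rw [hC.inf_eq_bot] at this
        rw [(Submodule.mem_bot K).1 this]
        simp
      · simp only [Finset.mem_insert, reduceCtorEq, Finset.mem_image, Option.some.injEq,
          exists_eq_right, Finset.mem_ssubsets, false_or] at ho
        exact ih Q' ho)
  have hyC : ∀ D ∈ C', A y D = 0 → D = 0 := hy none (Finset.mem_insert_self _ _)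
  have hyQ : ∀ Q' ⊂ Q, ∀ D ∈ spectralSubspace φ Q', A y D = 0 → D = 0 := fun Q' hQ' =>
    hy (some Q') (by simp [hQ'])
  have hC'T : C' ≤ T := by
    rintro D ⟨D', hD', rfl⟩
    exact D'.2
  set k := T ⊓ LinearMap.ker (A y) with hk
  have hmin : ∀ y', Module.finrank K k ≤ Module.finrank K ↥(T ⊓ LinearMap.ker (A y')) := by
    intro y'
    refine le_trans ?_ (hy₀ y')
    have e1 : Module.finrank K k + Module.finrank K C' ≤ Module.finrank K T := by
      have hd : k ⊓ C' = ⊥ := by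
        rw [Submodule.eq_bot_iff]
        rintro D ⟨⟨_, hD⟩, hD'⟩
        exact hyC D hD' hD
      rw [← Submodule.finrank_sup_add_finrank_inf_eq, hd, finrank_bot, add_zero]
      exact Submodule.finrank_mono (sup_le inf_le_left hC'T)
    have e2 : Module.finrank K ↥(T ⊓ LinearMap.ker (A y₀)) + Module.finrank K C'
        = Module.finrank K T := by
      have h1 := Submodule.finrank_add_eq_of_isCompl hC
      have h2 : Module.finrank K ↥((T ⊓ LinearMap.ker (A y₀)).comap T.subtype)
          = Module.finrank K ↥(T ⊓ LinearMap.ker (A y₀)) :=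
        (Submodule.comapSubtypeEquivOfLe inf_le_left).finrank_eq
      have h3 : Module.finrank K C' = Module.finrank K C :=
        (Submodule.equivMapOfInjective T.subtype T.subtype_injective C).finrank_eq.symm
      omega
    omega
  refine ⟨y, fun D hD h0 => ?_⟩
  by_contra hD0
  have hDk : D ∈ k := ⟨hD, h0⟩
  -- If φ x vanished on the whole kernel, D would lie in the subspace of Q \ {x}, where `y` is
  -- injective.
  have hx : ∀ x ∈ Q, ∃ D' ∈ k, φ x D' ≠ 0 := by
    intro x hxQ
    by_contra hc
    push Not at hc
    refine hD0 (hyQ (Q.erase x) (Finset.erase_ssubset hxQ) D ?_ h0)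
    intro x' hx'
    by_cases hxx : x' = x
    · rw [hxx]; exact hc D hDk
    · exact hD x' fun hm => hx' (Finset.mem_erase.2 ⟨hxx, hm⟩)
  -- Otherwise raising the coefficient of x adds a direction outside the image and strictly shrinks
  -- the kernel, against minimality. So the image of `T` contains all f x with x in `Q`, although
  -- its dimension is below that of `T`.
  have him : ∀ x ∈ Q, f x ∈ T.map (A y) := by
    intro x hxQ
    obtain ⟨D', hD', hφ⟩ := hx x hxQ
    by_contra hc
    have hpert : ∀ E, A (y + Pi.single x 1) E = A y E + φ x E • f x := by
      intro E
      rw [map_add, LinearMap.add_apply]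
      congr 1
      rw [hA, rankOneFamily_apply, Finset.sum_eq_single x]
      · simp
      · intro b _ hb
        simp [hb]
      · simp
    have hlt : T ⊓ LinearMap.ker (A (y + Pi.single x 1)) < k := by
      refine lt_of_le_of_ne ?_ ?_
      · rintro E ⟨hE, hE0⟩
        replace hE0 : A (y + Pi.single x 1) E = 0 := hE0
        rw [hpert] at hE0
        have hz : φ x E = 0 := by
          by_contra hz
          apply hc
          refine ⟨-(φ x E)⁻¹ • E, T.smul_mem _ hE, ?_⟩
          rw [map_smul, eq_neg_of_add_eq_zero_left hE0, smul_neg, neg_smul, neg_neg, smul_smul,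
            inv_mul_cancel₀ hz, one_smul]
        rw [hz, zero_smul, add_zero] at hE0
        exact ⟨hE, hE0⟩
      · intro heq
        rw [← heq] at hD'
        have h1 : A (y + Pi.single x 1) D' = 0 := hD'.2
        rw [heq] at hD'
        rw [hpert, show A y D' = 0 from hD'.2, zero_add] at h1
        rcases smul_eq_zero.1 h1 with h2 | h2
        · exact hφ h2
        · exact hc (h2 ▸ Submodule.zero_mem _)
    exact absurd (hmin _) (not_le.2 (Submodule.finrank_lt_finrank_of_lt hlt))
  have h1 : Module.finrank K (Submodule.span K (f '' (Q : Set X)))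
      ≤ Module.finrank K (T.map (A y)) := by
    apply Submodule.finrank_mono
    rw [Submodule.span_le]
    rintro _ ⟨x, hxQ, rfl⟩
    exact him x hxQ
  have h2 : Module.finrank K (T.map (A y)) + Module.finrank K k = Module.finrank K T := by
    have := LinearMap.finrank_range_add_finrank_ker ((A y).domRestrict T)
    rw [LinearMap.range_domRestrict] at this
    have hk' : Module.finrank K (LinearMap.ker ((A y).domRestrict T)) = Module.finrank K k := by
      have e : (LinearMap.ker ((A y).domRestrict T)).map T.subtype = k := by
        ext E
        simp [hk, LinearMap.mem_ker, and_comm]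
      rw [← e]
      exact (Submodule.equivMapOfInjective T.subtype T.subtype_injective _).finrank_eq
    omega
  have h3 : 0 < Module.finrank K k := by
    rw [Module.finrank_pos_iff]
    exact ⟨⟨D, hDk⟩, 0, fun e => hD0 (congrArg Subtype.val e)⟩
  have : Module.finrank K T ≤ _ := h Q
  omega

end Rado

/-! ### Matrices of linear forms with distinct leading variables -/

/-- The matrix with entries `∑ l, c i j l * y l`, applied to the vector `D`. -/
def labelledRow {K ι κ L : Type*} [Field K] [Fintype κ] [Fintype L] (c : ι → κ → L → K)
    (y : L → K) (D : κ → K) (i : ι) : K := ∑ j, (∑ l, c i j l * y l) * D j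

/-- A matrix of linear forms whose leading variables are distinct along every row and every
column, and which has at least as many rows as columns, has independent columns for a suitable
choice of the variables. -/
theorem exists_labelled_injective {K ι κ L O : Type*} [Field K] [Infinite K] [Fintype κ]
    [Fintype L] [LinearOrder O] (c : ι → κ → L → K) (ℓ : ι → κ → L) (w : L → O)
    (I : Finset ι) (J : Finset κ) (hcard : J.card ≤ I.card)
    (hc : ∀ i ∈ I, ∀ j ∈ J, c i j (ℓ i j) ≠ 0)
    (hdom : ∀ i ∈ I, ∀ j ∈ J, ∀ l, c i j l ≠ 0 → l = ℓ i j ∨ w l < w (ℓ i j))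
    (hrow : ∀ i ∈ I, ∀ j ∈ J, ∀ j' ∈ J, ℓ i j = ℓ i j' → j = j')
    (hcol : ∀ j ∈ J, ∀ i ∈ I, ∀ i' ∈ I, ℓ i j = ℓ i' j → i = i') :
    ∃ y : L → K, ∀ D : κ → K, (∀ j ∉ J, D j = 0) → (∀ i ∈ I, labelledRow c y D i = 0) →
      D = 0 := by
  classical
  induction hn : J.card using Nat.strong_induction_on generalizing I J with
  | _ n ih =>
  subst hn
  rcases J.eq_empty_or_nonempty with rfl | hJ
  · exact ⟨0, fun D hD _ => funext fun j => hD j (Finset.notMem_empty j)⟩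
  have hI : I.Nonempty := Finset.card_pos.1 (lt_of_lt_of_le (Finset.card_pos.2 hJ) hcard)
  -- By maximality, l₀ occurs in an entry only as its leading variable; these positions form a
  -- partial permutation matrix. Its rows and columns are removed before recursing.
  obtain ⟨⟨i₀, j₀⟩, hmem, hmax⟩ := (I ×ˢ J).exists_max_image (fun p => w (ℓ p.1 p.2))
    (hI.product hJ)
  rw [Finset.mem_product] at hmem
  set l₀ := ℓ i₀ j₀ with hl₀
  have hmax' : ∀ i ∈ I, ∀ j ∈ J, w (ℓ i j) ≤ w l₀ := fun i hi j hj =>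
    hmax (i, j) (Finset.mem_product.2 ⟨hi, hj⟩)
  have hl : ∀ i ∈ I, ∀ j ∈ J, c i j l₀ ≠ 0 → ℓ i j = l₀ := by
    intro i hi j hj h
    rcases hdom i hi j hj l₀ h with h | h
    · exact h.symm
    · exact absurd (hmax' i hi j hj) (not_le.2 h)
  set I₁ := I.filter fun i => ∃ j ∈ J, ℓ i j = l₀ with hI₁
  set J₁ := J.filter fun j => ∃ i ∈ I, ℓ i j = l₀ with hJ₁
  have hIJ : I₁.card ≤ J₁.card := by
    have : ∀ i ∈ I₁, ∃ j ∈ J₁, ℓ i j = l₀ := by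
      intro i hi
      obtain ⟨hi, j, hj, h⟩ := Finset.mem_filter.1 hi
      exact ⟨j, Finset.mem_filter.2 ⟨hj, i, hi, h⟩, h⟩
    have hne : Nonempty κ := ⟨j₀⟩
    choose! g hg hg' using this
    refine Finset.card_le_card_of_injOn g hg fun i hi i' hi' h => ?_
    have hgi := hg i hi
    have e := hg' i hi
    have e' := hg' i' hi'
    rw [← h] at e'
    exact hcol (g i) (Finset.mem_filter.1 hgi).1 i (Finset.mem_filter.1 hi).1 i'
      (Finset.mem_filter.1 hi').1 (e.trans e'.symm)
  have hIs : I₁ ⊆ I := Finset.filter_subset _ _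
  have hJs : J₁ ⊆ J := Finset.filter_subset _ _
  have hj₀ : j₀ ∈ J₁ := Finset.mem_filter.2 ⟨hmem.2, i₀, hmem.1, rfl⟩
  have hJpos : 0 < J₁.card := Finset.card_pos.2 ⟨j₀, hj₀⟩
  have hJle := Finset.card_le_card hJs
  obtain ⟨y', hy'⟩ := ih (J \ J₁).card
    (by rw [Finset.card_sdiff_of_subset hJs]; omega) (I \ I₁) (J \ J₁)
    (by rw [Finset.card_sdiff_of_subset hJs, Finset.card_sdiff_of_subset hIs]; omega)
    (fun i hi j hj => hc i (Finset.mem_sdiff.1 hi).1 j (Finset.mem_sdiff.1 hj).1)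
    (fun i hi j hj => hdom i (Finset.mem_sdiff.1 hi).1 j (Finset.mem_sdiff.1 hj).1)
    (fun i hi j hj j' hj' => hrow i (Finset.mem_sdiff.1 hi).1 j (Finset.mem_sdiff.1 hj).1 j'
      (Finset.mem_sdiff.1 hj').1)
    (fun j hj i hi i' hi' => hcol j (Finset.mem_sdiff.1 hj).1 i (Finset.mem_sdiff.1 hi).1 i'
      (Finset.mem_sdiff.1 hi').1) rfl
  let T : Submodule K (κ → K) :=
    { carrier := {D | ∀ j ∉ J, D j = 0}
      add_mem' := fun ha hb j hj => by simp [ha j hj, hb j hj]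
      zero_mem' := fun _ _ => rfl
      smul_mem' := fun a D hD j hj => by simp [hD j hj] }
  -- Rows containing l₀ are multiplied by t while y(l₀) is raised by t⁻¹. At t = 0 they retain only
  -- the coefficients of l₀, so `L₁` is block triangular and injective on `T`; then all but finitely
  -- many t work.
  let L₁ : (κ → K) →ₗ[K] (ι → K) := LinearMap.pi fun i =>
    if i ∈ I₁ then ∑ j, c i j l₀ • LinearMap.proj j
    else if i ∈ I then ∑ j, (∑ l, c i j l * y' l) • LinearMap.proj j else 0
  let L₂ : (κ → K) →ₗ[K] (ι → K) := LinearMap.pi fun i =>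
    if i ∈ I₁ then ∑ j, (∑ l, c i j l * y' l) • LinearMap.proj j else 0
  have hL₁ : ∀ D i, i ∈ I₁ → L₁ D i = ∑ j, c i j l₀ * D j := by
    intro D i hi
    simp [L₁, hi, LinearMap.sum_apply]
  have hL₁' : ∀ D i, i ∉ I₁ → i ∈ I → L₁ D i = labelledRow c y' D i := by
    intro D i hi hi'
    simp [L₁, hi, hi', LinearMap.sum_apply, labelledRow]
  have hL₂ : ∀ D i, i ∈ I₁ → L₂ D i = labelledRow c y' D i := by
    intro D i hi
    simp [L₂, hi, LinearMap.sum_apply, labelledRow]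
  have hinj : Function.Injective (L₁.domRestrict T) := by
    rw [injective_iff_map_eq_zero]
    rintro ⟨D, hD⟩ h0
    replace h0 : L₁ D = 0 := h0
    have hD₁ : ∀ j ∈ J₁, D j = 0 := by
      intro j hj
      obtain ⟨hjJ, i, hi, hij⟩ := Finset.mem_filter.1 hj
      have hi₁ : i ∈ I₁ := Finset.mem_filter.2 ⟨hi, j, hjJ, hij⟩
      have h1 := congrFun h0 i
      rw [hL₁ D i hi₁, Finset.sum_eq_single j] at h1
      · have h2 := hc i hi j hjJ
        rw [hij] at h2
        exact (mul_eq_zero.1 h1).resolve_left h2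
      · intro j' _ hne
        by_cases hj' : j' ∈ J
        · by_cases hz : c i j' l₀ = 0
          · rw [hz, zero_mul]
          · exact absurd (hrow i hi j' hj' j hjJ ((hl i hi j' hj' hz).trans hij.symm)) hne
        · rw [hD j' hj', mul_zero]
      · simp
    refine Subtype.ext (hy' D ?_ ?_)
    · intro j hj
      by_cases hjJ : j ∈ J
      · exact hD₁ j (by_contra fun h => hj (Finset.mem_sdiff.2 ⟨hjJ, h⟩))
      · exact hD j hjJ
    · intro i hi
      rw [Finset.mem_sdiff] at hi
      rw [← hL₁' D i hi.2 hi.1, h0]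
      rfl
  obtain ⟨t, ht⟩ := ((finite_not_injective_pencil _ (L₂.domRestrict T) hinj).union
    (Set.finite_singleton (0 : K))).exists_notMem
  simp only [Set.mem_union, not_or, Set.mem_ofPred_eq, not_not, Set.mem_singleton_iff] at ht
  obtain ⟨ht, ht0⟩ := ht
  refine ⟨y' + Pi.single l₀ t⁻¹, fun D hD hrows => ?_⟩
  have hexp : ∀ i, labelledRow c (y' + Pi.single l₀ t⁻¹) D i
      = labelledRow c y' D i + t⁻¹ * ∑ j, c i j l₀ * D j := by
    intro i
    simp only [labelledRow, Pi.add_apply, mul_add, Finset.sum_add_distrib, add_mul,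
      Finset.mul_sum, Pi.single_apply, mul_ite, mul_zero, Finset.sum_ite_eq', Finset.mem_univ,
      if_true]
    congr 1
    exact Finset.sum_congr rfl fun j _ => by ring
  rw [injective_iff_map_eq_zero] at ht
  have := ht ⟨D, hD⟩ ?_
  · exact congrArg Subtype.val this
  · change L₁ D + t • L₂ D = 0
    funext i
    simp only [Pi.add_apply, Pi.smul_apply, smul_eq_mul, Pi.zero_apply]
    by_cases hi : i ∈ I₁
    · have h1 := hrows i (hIs hi)
      rw [hexp] at h1
      rw [hL₁ D i hi, hL₂ D i hi]
      have : t * (labelledRow c y' D i + t⁻¹ * ∑ j, c i j l₀ * D j) = 0 := by rw [h1, mul_zero]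
      rw [mul_add, ← mul_assoc, mul_inv_cancel₀ ht0, one_mul] at this
      rw [add_comm, this]
    · by_cases hiI : i ∈ I
      · have h1 := hrows i hiI
        have h2 : ∑ j, c i j l₀ * D j = 0 := by
          refine Finset.sum_eq_zero fun j _ => ?_
          by_cases hj : j ∈ J
          · by_cases hz : c i j l₀ = 0
            · rw [hz, zero_mul]
            · exact absurd (Finset.mem_filter.2 ⟨hiI, j, hj, hl i hiI j hj hz⟩) hi
          · rw [hD j hj, mul_zero]
        rw [hexp, h2, mul_zero, add_zero] at h1
        rw [hL₁' D i hi hiI, h1]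
        simp [L₂, hi]
      · simp [L₁, L₂, hi, hiI]

/-! ### Interpolating characters and the blocks of paired frequencies -/

section Amplified

variable {A C : Type*} [AddCommGroup A] [Fintype A] [AddCommGroup C] [Fintype C]

/-- On a set of `N` points of a finite abelian group, some `N` characters already determine every
function supported there. -/
theorem exists_interpolating_characters (Ω : Finset A) :
    ∃ S : Finset (AddChar A ℂ), S.card ≤ Ω.card ∧
      ∀ D : A → ℂ, (∀ a ∉ Ω, D a = 0) → (∀ ψ ∈ S, ∑ a, D a * ψ a = 0) → D = 0 := by
  classical
  let r : (A → ℂ) →ₗ[ℂ] (Ω → ℂ) := LinearMap.funLeft ℂ ℂ Subtype.val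
  -- The characters span all functions on A, so their restrictions to `Ω` span; a basis chosen among
  -- these restrictions has at most |Ω| members.
  obtain ⟨κ, g, hg, hspan, hli⟩ := exists_linearIndependent' ℂ
    (fun ψ : AddChar A ℂ => r ψ)
  have hr : Function.Surjective r :=
    LinearMap.funLeft_surjective_of_injective ℂ ℂ _ Subtype.val_injective
  have hspan' : Submodule.span ℂ (Set.range fun ψ : AddChar A ℂ => r ψ) = ⊤ := by
    have h1 := (AddChar.complexBasis A).span_eq
    rw [AddChar.coe_complexBasis] at h1
    have h2 : (Set.range fun ψ : AddChar A ℂ => r ψ) = r '' Set.range fun ψ : AddChar A ℂ => (ψ : A → ℂ) := by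
      rw [← Set.range_comp]; rfl
    rw [h2, Submodule.span_image, h1, Submodule.map_top, LinearMap.range_eq_top.2 hr]
  rw [hspan'] at hspan
  have : Fintype κ := Fintype.ofInjective g hg
  refine ⟨Finset.univ.image g, ?_, fun D hD h => ?_⟩
  · rw [Finset.card_image_of_injective _ hg, Finset.card_univ]
    simpa using hli.fintype_card_le_finrank
  let Λ : (Ω → ℂ) →ₗ[ℂ] ℂ := ∑ a : Ω, D a • LinearMap.proj a
  have hΛ : ∀ f, Λ f = ∑ a : Ω, D a * f a := fun f => by simp [Λ, LinearMap.sum_apply]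
  have hsum : ∀ f : A → ℂ, ∑ a, D a * f a = ∑ a : Ω, D a * f a := by
    intro f
    rw [Finset.sum_coe_sort Ω fun a => D a * f a]
    exact (Finset.sum_subset (Finset.subset_univ _) fun a _ ha => by rw [hD a ha, zero_mul]).symm
  have hΛ0 : Λ = 0 := by
    rw [← LinearMap.ker_eq_top, eq_top_iff, ← hspan, Submodule.span_le]
    rintro _ ⟨x, rfl⟩
    have := h (g x) (Finset.mem_image_of_mem g (Finset.mem_univ x))
    rw [hsum] at this
    change Λ _ = 0
    rw [hΛ]
    exact this
  funext a
  by_cases ha : a ∈ Ω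
  · have := LinearMap.congr_fun hΛ0 (Pi.single ⟨a, ha⟩ 1)
    rw [hΛ] at this
    simpa [Pi.single_apply] using this
  · exact hD a ha

/-- The block of equations attached to the pair of frequencies `ψ`, `-ψ` can be made injective. -/
theorem exists_frequency_block {O : Type*} [LinearOrder O] [DecidableEq C]
    (ψ : AddChar A ℂ) (S : Finset (AddChar A ℂ)) (Ω R P : Finset C) (v : C → O)
    (hPR : P ⊆ R) (hP : ∀ u ∈ P, ∀ j ∈ Ω, u + u = 0 ∨ v (j - u) < v (j + u))
    (hRP : R.card ≤ 2 * P.card) (hcard : 2 * (S.card * Ω.card) ≤ Fintype.card A * R.card) :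
    ∃ z : AddChar A ℂ × AddChar A ℂ × AddChar A ℂ × C → ℂ,
      ∀ D : AddChar A ℂ × AddChar A ℂ × C → ℂ,
      (∀ α χ j, D (α, χ, j) ≠ 0 → (χ = ψ ∨ χ = -ψ) ∧ χ - α ∈ S ∧ j ∈ Ω) →
      (∀ β, ∀ u ∈ R, ∑ α, ∑ j, (D (α, ψ, j) * z (β, α, ψ, j + u)
        + D (α, -ψ, j) * z (β, α, -ψ, j - u)) = 0) → D = 0 := by
  classical
  let c : AddChar A ℂ × C → AddChar A ℂ × AddChar A ℂ × C →
      AddChar A ℂ × AddChar A ℂ × AddChar A ℂ × C → ℂ := fun i k l =>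
    (if k.2.1 = ψ then (if l = (i.1, k.1, k.2.1, k.2.2 + i.2) then 1 else 0) else 0)
    + (if k.2.1 = -ψ then (if l = (i.1, k.1, k.2.1, k.2.2 - i.2) then 1 else 0) else 0)
  let ℓ : AddChar A ℂ × C → AddChar A ℂ × AddChar A ℂ × C →
      AddChar A ℂ × AddChar A ℂ × AddChar A ℂ × C := fun i k =>
    (i.1, k.1, k.2.1, if k.2.1 = ψ then k.2.2 + i.2 else k.2.2 - i.2)
  -- For ψ = -ψ an entry contains both j + u and j - u and is unchanged by u ↦ -u, so only the
  -- oriented half `P` is used and `v` selects the leading variable. For ψ ≠ -ψ every entry on `J`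
  -- is a single variable.
  let I : Finset (AddChar A ℂ × C) := Finset.univ ×ˢ (if ψ = -ψ then P else R)
  let J : Finset (AddChar A ℂ × AddChar A ℂ × C) :=
    Finset.univ.filter fun k => (k.2.1 = ψ ∨ k.2.1 = -ψ) ∧ k.2.1 - k.1 ∈ S ∧ k.2.2 ∈ Ω
  have hJ : J.card ≤ ({ψ, -ψ} : Finset (AddChar A ℂ)).card * (S.card * Ω.card) := by
    rw [← Finset.card_product, ← Finset.card_product]
    refine (Finset.card_le_card ?_).trans (Finset.card_image_le
      (f := fun t : AddChar A ℂ × AddChar A ℂ × C => (t.1 - t.2.1, t.1, t.2.2)))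
    rintro ⟨α, χ, j⟩ hk
    obtain ⟨h1, h2, h3⟩ := (Finset.mem_filter.1 hk).2
    exact Finset.mem_image.2 ⟨(χ, χ - α, j), by simp_all, by simp⟩
  have hI : I.card = Fintype.card A * (if ψ = -ψ then P else R).card := by
    rw [Finset.card_product, Finset.card_univ, AddChar.card_eq]
  have hIJ : J.card ≤ I.card := by
    rw [hI]
    refine hJ.trans ?_
    by_cases h : ψ = -ψ
    · rw [if_pos h, ← h]
      simp only [Finset.mem_singleton, Finset.insert_eq_of_mem, Finset.card_singleton]
      have := Nat.mul_le_mul_left (Fintype.card A) hRP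
      nlinarith
    · rw [if_neg h, Finset.card_pair h]
      exact hcard
  have hIR : ∀ i ∈ I, i.2 ∈ R := by
    intro i hi
    have := (Finset.mem_product.1 hi).2
    split_ifs at this
    · exact hPR this
    · exact this
  obtain ⟨z, hz⟩ := exists_labelled_injective c ℓ (fun l => v l.2.2.2) I J hIJ (by
      rintro ⟨β, u⟩ hi ⟨α, χ, j⟩ hk
      obtain ⟨h1, -, -⟩ := (Finset.mem_filter.1 hk).2
      simp only at h1
      by_cases h : χ = ψ
      · simp only [c, ℓ, h, if_true]
        split_ifs <;> norm_num
      · simp only [c, ℓ, if_neg h, if_pos (h1.resolve_left h)]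
        norm_num) (by
      rintro ⟨β, u⟩ hi ⟨α, χ, j⟩ hk l hl
      obtain ⟨h1, -, h3⟩ := (Finset.mem_filter.1 hk).2
      simp only at h1 h3
      by_cases h : χ = ψ
      · by_cases h' : χ = -ψ
        · have hreal : ψ = -ψ := h ▸ h'
          have hu : u ∈ P := by
            have := (Finset.mem_product.1 hi).2
            rwa [if_pos hreal] at this
          by_cases e : l = (β, α, χ, j + u)
          · left; simpa [ℓ, h] using (h ▸ e)
          · have e' : l = (β, α, χ, j - u) := by
              by_contra e'
              exact hl (by simp [c, e, e'])
            rcases hP u hu j h3 with h4 | h4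
            · left
              rw [e']
              simp only [ℓ, h, if_true]
              rw [sub_eq_add_neg, ← eq_neg_of_add_eq_zero_left h4]
            · right
              rw [e']
              simpa [ℓ, h] using h4
        · left
          by_contra e
          refine hl ?_
          simp only [ℓ, h, if_true] at e
          simp only [c, h, if_true]
          rw [if_neg e, if_neg (fun h5 => h' (h.trans h5)), zero_add]
      · left
        by_contra e
        refine hl ?_
        simp only [ℓ, h, if_false] at e
        simp only [c, h, if_false]
        rw [if_neg e]
        simp) (by
      rintro ⟨β, u⟩ - ⟨α, χ, j⟩ - ⟨α', χ', j'⟩ - h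
      simp only [ℓ, Prod.mk.injEq] at h
      obtain ⟨-, rfl, rfl, h⟩ := h
      split_ifs at h
      · rw [add_right_cancel h]
      · rw [sub_left_injective h]) (by
      rintro ⟨α, χ, j⟩ - ⟨β, u⟩ - ⟨β', u'⟩ - h
      simp only [ℓ, Prod.mk.injEq] at h
      obtain ⟨rfl, -, -, h⟩ := h
      split_ifs at h
      · rw [add_left_cancel h]
      · rw [sub_right_injective h])
  refine ⟨z, fun D hD heq => hz D ?_ ?_⟩
  · rintro ⟨α, χ, j⟩ hk
    by_contra h0
    exact hk (Finset.mem_filter.2 ⟨Finset.mem_univ _, hD α χ j h0⟩)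
  · rintro ⟨β, u⟩ hi
    rw [← heq β u (hIR _ hi)]
    have hent : ∀ k : AddChar A ℂ × AddChar A ℂ × C, ∑ l, c (β, u) k l * z l
        = (if k.2.1 = ψ then z (β, k.1, k.2.1, k.2.2 + u) else 0)
          + (if k.2.1 = -ψ then z (β, k.1, k.2.1, k.2.2 - u) else 0) := by
      intro k
      simp only [c, add_mul, Finset.sum_add_distrib]
      congr 1 <;> split_ifs <;> simp
    simp only [labelledRow, hent, Fintype.sum_prod_type]
    refine Finset.sum_congr rfl fun α _ => ?_
    rw [Finset.sum_comm]
    refine Finset.sum_congr rfl fun j _ => ?_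
    simp only [add_mul, Finset.sum_add_distrib, ite_mul, zero_mul, Finset.sum_ite_eq',
      Finset.mem_univ, if_true]
    ring

end Amplified

/-! ### From an array of backgrounds to a single one -/

section Amplification

variable {G : Type*} [AddCommGroup G] [Fintype G]

/-- The symmetrised correlation of `D` with `Y` at the shift `s`. -/
def symCorr {K : Type*} [CommRing K] (Y D : G → K) (s : G) : K :=
  ∑ p, D p * (Y (p + s) + Y (p - s))

/-- Expanding Y in characters turns translations into scalars: each character contributes a rank-one
map in D, weighted by a Fourier coefficient of Y. This is the form required for matroid
intersection. -/
theorem symCorr_eq_sum_addChar (Y D : G → ℂ) (s : G) :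
    symCorr Y D s = ∑ χ, ((AddChar.complexBasis G).repr Y χ * ∑ p, D p * χ p) * (χ s + χ (-s)) := by
  have hY : ∀ q, Y q = ∑ χ, (AddChar.complexBasis G).repr Y χ * χ q := by
    intro q
    have := congrFun ((AddChar.complexBasis G).sum_repr Y) q
    simpa using this.symm
  simp only [symCorr]
  simp_rw [hY, ← Finset.sum_add_distrib, Finset.mul_sum, Finset.sum_mul]
  rw [Finset.sum_comm]
  refine Finset.sum_congr rfl fun χ _ => Finset.sum_congr rfl fun p _ => ?_
  rw [AddChar.map_add_eq_mul, sub_eq_add_neg, AddChar.map_add_eq_mul]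
  ring

/-- If a square array of backgrounds jointly determines several samples at once, then a single
background determines a single sample. -/
theorem exists_background_of_array {Γ : Type*} [Fintype Γ] [Nonempty Γ] (Ω R : Set G)
    (Y : Γ → Γ → G → ℂ)
    (hY : ∀ D : Γ → G → ℂ, (∀ α p, D α p ≠ 0 → p ∈ Ω) →
      (∀ β, ∀ s ∈ R, ∑ α, symCorr (Y β α) (D α) s = 0) → D = 0) :
    ∃ Y : G → ℂ, ∀ D : G → ℂ, (∀ p, D p ≠ 0 → p ∈ Ω) → (∀ s ∈ R, symCorr Y D s = 0) → D = 0 := by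
  classical
  let W : Submodule ℂ (G → ℂ) :=
    { carrier := {D | ∀ p ∉ Ω, D p = 0}
      add_mem' := fun ha hb j hj => by simp [ha j hj, hb j hj]
      zero_mem' := fun _ _ => rfl
      smul_mem' := fun a D hD j hj => by simp [hD j hj] }
  let φ : AddChar G ℂ → W →ₗ[ℂ] ℂ := fun χ => (∑ p, χ p • LinearMap.proj p) ∘ₗ W.subtype
  have hφ : ∀ χ (D : W), φ χ D = ∑ p, (D : G → ℂ) p * χ p := by
    intro χ D
    simp [φ, mul_comm]
  let f : AddChar G ℂ → R → ℂ := fun χ s => χ s + χ (-(s : G))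
  have hfam : ∀ (Z : G → ℂ) (D : W) (s : R),
      rankOneFamily φ f (fun χ => (AddChar.complexBasis G).repr Z χ) D s = symCorr Z D s := by
    intro Z D s
    rw [rankOneFamily_apply, symCorr_eq_sum_addChar]
    simp [hφ, f]
  obtain ⟨y, hy⟩ := exists_rankOneFamily_injective φ f (by
    intro Q
    set T := spectralSubspace φ Q
    set E := Submodule.span ℂ (f '' (Q : Set (AddChar G ℂ)))
    have hmem : ∀ y, ∀ D ∈ T, rankOneFamily φ f y D ∈ E := by
      intro y D hD
      rw [rankOneFamily_apply]
      refine Submodule.sum_mem _ fun χ _ => ?_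
      by_cases hχ : χ ∈ Q
      · exact Submodule.smul_mem _ _ (Submodule.subset_span ⟨χ, hχ, rfl⟩)
      · rw [hD χ hχ, mul_zero, zero_smul]
        exact Submodule.zero_mem _
    -- The array maps |Γ| copies of `T` injectively into |Γ| copies of `E`; dividing the dimensions
    -- by |Γ| gives the inequality for `Q`.
    let Φ : (Γ → T) →ₗ[ℂ] (Γ → E) := LinearMap.pi fun β => ∑ α,
      (LinearMap.restrict
        (rankOneFamily φ f fun χ => (AddChar.complexBasis G).repr (Y β α) χ) (hmem _))
        ∘ₗ LinearMap.proj α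
    have hΦ : Function.Injective Φ := by
      rw [injective_iff_map_eq_zero]
      intro D hD
      have h0 := hY (fun α => ((D α : W) : G → ℂ)) (fun α p hp => by
        by_contra hc
        exact hp ((D α : W).2 p hc)) (by
        intro β s hs
        have h1 := congrFun (congrArg (Subtype.val) (congrFun hD β)) ⟨s, hs⟩
        simpa [Φ, LinearMap.sum_apply, LinearMap.coe_restrict_apply, hfam] using h1)
      funext α
      exact Subtype.ext (Subtype.ext (congrFun h0 α))
    have h1 := LinearMap.finrank_le_finrank_of_injective hΦ
    rw [Module.finrank_pi_fintype, Module.finrank_pi_fintype, Finset.sum_const, Finset.sum_const,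
      smul_eq_mul, smul_eq_mul] at h1
    exact Nat.le_of_mul_le_mul_left h1 (Finset.card_pos.2 Finset.univ_nonempty))
  let Z : G → ℂ := ∑ χ, y χ • AddChar.complexBasis G χ
  have hZ : (fun χ => (AddChar.complexBasis G).repr Z χ) = y := by
    funext χ
    exact congrFun ((AddChar.complexBasis G).repr_sum_self y) χ
  refine ⟨Z, fun D hD h => ?_⟩
  rw [injective_iff_map_eq_zero] at hy
  have := hy ⟨D, fun p hp => by_contra fun h0 => hp (hD p h0)⟩ (by
    funext s
    rw [← hZ, hfam]
    exact h s s.2)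
  exact congrArg Subtype.val this

end Amplification

/-! ### Decoupling the frequencies of the wrapping factor -/

section Product

variable {A C : Type*} [AddCommGroup A] [Fintype A] [AddCommGroup C] [Fintype C]

/-- All shifts in A are available, so a Fourier transform there separates the equations, tying ψ
only to -ψ. The background for sample α is given only frequencies in α + S; each block then has at
most 2|S||Ω| unknowns against |A||R| equations, and the |S| visible frequencies still determine the
sample. -/
theorem exists_background_array {O : Type*} [LinearOrder O] [DecidableEq C]
    (Ω' : Finset A) (Ω R P : Finset C) (v : C → O)
    (hPR : P ⊆ R) (hP : ∀ u ∈ P, ∀ j ∈ Ω, u + u = 0 ∨ v (j - u) < v (j + u))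
    (hRP : R.card ≤ 2 * P.card) (hcard : 2 * (Ω'.card * Ω.card) ≤ Fintype.card A * R.card) :
    ∃ Y : AddChar A ℂ → AddChar A ℂ → A × C → ℂ, ∀ D : AddChar A ℂ → A × C → ℂ,
      (∀ α p, D α p ≠ 0 → p.1 ∈ Ω' ∧ p.2 ∈ Ω) →
      (∀ β, ∀ s : A × C, s.2 ∈ R → ∑ α, symCorr (Y β α) (D α) s = 0) → D = 0 := by
  classical
  obtain ⟨S, hS, hint⟩ := exists_interpolating_characters Ω'
  have hcard' : 2 * (S.card * Ω.card) ≤ Fintype.card A * R.card :=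
    le_trans (Nat.mul_le_mul_left 2 (Nat.mul_le_mul_right _ hS)) hcard
  choose z hz using fun ψ : AddChar A ℂ => exists_frequency_block ψ S Ω R P v hPR hP hRP hcard'
  let en := Fintype.equivFin (AddChar A ℂ)
  -- One representative of each pair {ψ, -ψ}, so that both frequencies draw their variables from the
  -- same block.
  let rep : AddChar A ℂ → AddChar A ℂ := fun ψ => if en ψ ≤ en (-ψ) then ψ else -ψ
  have hrep : ∀ ψ, rep ψ = ψ ∨ rep ψ = -ψ := by
    intro ψ
    by_cases h : en ψ ≤ en (-ψ)
    · left; simp [rep, h]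
    · right; simp [rep, h]
  have hrepneg : ∀ ψ, rep (-ψ) = rep ψ := by
    intro ψ
    simp only [rep, neg_neg]
    rcases lt_trichotomy (en ψ) (en (-ψ)) with h | h | h
    · rw [if_neg (not_le.2 h), if_pos h.le]
    · rw [if_pos h.symm.le, if_pos h.le]; exact (en.injective h).symm
    · rw [if_pos h.le, if_neg (not_le.2 h)]
  let Z : AddChar A ℂ → AddChar A ℂ → AddChar A ℂ → C → ℂ := fun β α ψ q =>
    if ψ - α ∈ S then z (rep ψ) (β, α, ψ, q) else 0
  refine ⟨fun β α p => ∑ ψ, ψ p.1 * Z β α ψ p.2, fun D hD heq => ?_⟩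
  let T : AddChar A ℂ → AddChar A ℂ → C → ℂ := fun α ψ j => ∑ a, D α (a, j) * ψ a
  have hexp : ∀ β α (e : A) (u : C), symCorr (fun p => ∑ ψ, ψ p.1 * Z β α ψ p.2) (D α) (e, u)
      = ∑ ψ, (∑ j, (T α ψ j * Z β α ψ (j + u) + T α (-ψ) j * Z β α (-ψ) (j - u))) * ψ e := by
    intro β α e u
    have h1 : symCorr (fun p => ∑ ψ, ψ p.1 * Z β α ψ p.2) (D α) (e, u)
        = ∑ ψ, (∑ j, T α ψ j * Z β α ψ (j + u)) * ψ e
          + ∑ ψ, (∑ j, T α ψ j * Z β α ψ (j - u)) * ψ (-e) := by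
      simp only [symCorr, Fintype.sum_prod_type, mul_add, Finset.sum_add_distrib, Prod.fst_add,
        Prod.snd_add, Prod.fst_sub, Prod.snd_sub, Finset.mul_sum, Finset.sum_mul, T]
      congr 1
      · rw [Finset.sum_comm' (t' := Finset.univ) (s' := fun _ => Finset.univ) (by simp)]
        rw [Finset.sum_congr rfl fun j _ => Finset.sum_comm]
        rw [Finset.sum_comm]
        refine Finset.sum_congr rfl fun ψ _ => Finset.sum_congr rfl fun j _ =>
          Finset.sum_congr rfl fun a _ => ?_
        rw [AddChar.map_add_eq_mul]
        ring
      · rw [Finset.sum_comm' (t' := Finset.univ) (s' := fun _ => Finset.univ) (by simp)]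
        rw [Finset.sum_congr rfl fun j _ => Finset.sum_comm]
        rw [Finset.sum_comm]
        refine Finset.sum_congr rfl fun ψ _ => Finset.sum_congr rfl fun j _ =>
          Finset.sum_congr rfl fun a _ => ?_
        rw [sub_eq_add_neg, AddChar.map_add_eq_mul]
        ring
    rw [h1, ← Equiv.sum_comp (Equiv.neg (AddChar A ℂ))
      (fun ψ => (∑ j, T α ψ j * Z β α ψ (j - u)) * ψ (-e)), ← Finset.sum_add_distrib]
    refine Finset.sum_congr rfl fun ψ _ => ?_
    simp only [Equiv.neg_apply, AddChar.neg_apply, neg_neg, Finset.sum_add_distrib, add_mul]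
  have hfreq : ∀ β ψ, ∀ u ∈ R,
      ∑ α, ∑ j, (T α ψ j * Z β α ψ (j + u) + T α (-ψ) j * Z β α (-ψ) (j - u)) = 0 := by
    intro β ψ u hu
    have hli := Fintype.linearIndependent_iff.1 (AddChar.linearIndependent A ℂ)
      (fun ψ => ∑ α, ∑ j, (T α ψ j * Z β α ψ (j + u) + T α (-ψ) j * Z β α (-ψ) (j - u))) (by
        funext e
        have := heq β (e, u) hu
        simp_rw [hexp] at this
        rw [Finset.sum_comm] at this
        simpa [Finset.sum_mul] using this)
    exact hli ψ
  have hT : ∀ α ψ j, ψ - α ∈ S → T α ψ j = 0 := by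
    intro α₀ ψ₀ j₀ hmem
    set ρ := rep ψ₀ with hρ
    have hρρ : rep ρ = ρ := by
      rcases hrep ψ₀ with h | h
      · rw [hρ, h, h]
      · rw [hρ, h, hrepneg, h]
    have hψρ : ψ₀ = ρ ∨ ψ₀ = -ρ := by
      rcases hrep ψ₀ with h | h
      · left; rw [hρ, h]
      · right; rw [hρ, h, neg_neg]
    let D' : AddChar A ℂ × AddChar A ℂ × C → ℂ := fun k =>
      if (k.2.1 = ρ ∨ k.2.1 = -ρ) ∧ k.2.1 - k.1 ∈ S then T k.1 k.2.1 k.2.2 else 0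
    have hD' := hz ρ D' (by
      intro α χ j h0
      simp only [D'] at h0
      split_ifs at h0 with h
      · refine ⟨h.1, h.2, ?_⟩
        by_contra hj
        refine h0 (Finset.sum_eq_zero fun a _ => ?_)
        have : D α (a, j) = 0 := by_contra fun hne => hj (hD α _ hne).2
        rw [this, zero_mul]
      · exact absurd rfl h0) (by
      intro β u hu
      rw [← hfreq β ρ u hu]
      refine Finset.sum_congr rfl fun α _ => Finset.sum_congr rfl fun j _ => ?_
      have e1 : D' (α, ρ, j) * z ρ (β, α, ρ, j + u) = T α ρ j * Z β α ρ (j + u) := by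
        simp only [D', Z, hρρ, true_or, true_and]
        split_ifs <;> simp
      have e2 : D' (α, -ρ, j) * z ρ (β, α, -ρ, j - u) = T α (-ρ) j * Z β α (-ρ) (j - u) := by
        simp only [D', Z, hrepneg, hρρ, or_true, true_and]
        split_ifs <;> simp
      rw [e1, e2])
    have := congrFun hD' (α₀, ψ₀, j₀)
    simpa [D', hψρ, hmem] using this
  funext α p
  obtain ⟨a, j⟩ := p
  -- Multiplication by α translates frequencies, moving the visible set α + S to `S`.
  have := hint (fun a => D α (a, j) * α a) (fun a ha => by
    have : D α (a, j) = 0 := by_contra fun hne => ha (hD α _ hne).1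
    rw [this, zero_mul]) (fun σ hσ => by
    have := hT α (σ + α) j (by simpa using hσ)
    rw [← this]
    refine Finset.sum_congr rfl fun a _ => ?_
    rw [AddChar.add_apply]
    ring)
  exact (mul_eq_zero.1 (congrFun this a)).resolve_right (AddChar.val_isUnit α a).ne_zero

/-- There is a complex background on a product group for which the correlations at the shifts
with second coordinate in `R` determine every sample supported on a product set. -/
theorem exists_background_prod {O : Type*} [LinearOrder O] [DecidableEq C]
    (Ω' : Finset A) (Ω R P : Finset C) (v : C → O)
    (hPR : P ⊆ R) (hP : ∀ u ∈ P, ∀ j ∈ Ω, u + u = 0 ∨ v (j - u) < v (j + u))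
    (hRP : R.card ≤ 2 * P.card) (hcard : 2 * (Ω'.card * Ω.card) ≤ Fintype.card A * R.card) :
    ∃ Y : A × C → ℂ, ∀ D : A × C → ℂ, (∀ p, D p ≠ 0 → p.1 ∈ Ω' ∧ p.2 ∈ Ω) →
      (∀ s : A × C, s.2 ∈ R → symCorr Y D s = 0) → D = 0 := by
  obtain ⟨Y, hY⟩ := exists_background_array Ω' Ω R P v hPR hP hRP hcard
  exact exists_background_of_array {p : A × C | p.1 ∈ Ω' ∧ p.2 ∈ Ω} {s : A × C | s.2 ∈ R} Y hY

end Product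

/-! ### Orienting shifts by sine waves, and the background for a box -/

section Orientation

/-- The sine wave of period `m` shifted by `c`, on `ZMod m`. -/
noncomputable def wave (m : ℕ) (c : ℝ) (x : ZMod m) : ℝ :=
  Real.sin (2 * Real.pi * ((x.val : ℝ) - c) / m)

theorem wave_intCast (m : ℕ) [NeZero m] (c : ℝ) (k : ℤ) :
    wave m c (k : ZMod m) = Real.sin (2 * Real.pi * ((k : ℝ) - c) / m) := by
  have hm : (m : ℝ) ≠ 0 := Nat.cast_ne_zero.2 (NeZero.ne m)
  have h1 : (((k : ZMod m).val : ℤ) : ℝ) = (k : ℝ) - m * ((k / m : ℤ) : ℝ) := by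
    rw [ZMod.val_intCast, Int.emod_def]
    push_cast
    ring
  have h2 : (((k : ZMod m).val : ℕ) : ℝ) = (k : ℝ) - m * ((k / m : ℤ) : ℝ) := by
    rw [← h1]; simp
  have h3 : 2 * Real.pi * ((k : ℝ) - m * ((k / m : ℤ) : ℝ) - c) / m
      = 2 * Real.pi * ((k : ℝ) - c) / m - ((k / m : ℤ) : ℝ) * (2 * Real.pi) := by
    field_simp
    ring
  rw [wave, h2, h3, Real.sin_sub_int_mul_two_pi]

theorem wave_neg (m : ℕ) [NeZero m] (x : ZMod m) : wave m 0 (-x) = -wave m 0 x := by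
  have h1 := wave_intCast m 0 (-(x.val : ℤ))
  have h2 := wave_intCast m 0 (x.val : ℤ)
  simp only [Int.cast_neg, Int.cast_natCast, ZMod.natCast_zmod_val, sub_zero] at h1 h2
  rw [h1, h2, ← Real.sin_neg]
  congr 1
  ring

theorem add_self_eq_zero_of_wave (m : ℕ) [NeZero m] (x : ZMod m) (h : wave m 0 x = 0) :
    x + x = 0 := by
  have hm : (m : ℝ) ≠ 0 := Nat.cast_ne_zero.2 (NeZero.ne m)
  rw [wave, sub_zero, Real.sin_eq_zero_iff] at h
  obtain ⟨k, hk⟩ := h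
  have h1 : (k : ℝ) * m = 2 * x.val := by
    field_simp at hk
    linarith
  have h2 : k * m = 2 * (x.val : ℤ) := by exact_mod_cast h1
  have h3 : ((2 * (x.val : ℤ) : ℤ) : ZMod m) = 0 := by rw [← h2]; simp
  simpa [two_mul] using h3

/-- The sum-to-product formula separates the point from the shift: where the cosine is positive, the
sign of the increment depends on the shift alone. -/
theorem wave_add_sub_wave_sub (m : ℕ) [NeZero m] (c : ℝ) (k : ℤ) (x : ZMod m) :
    wave m c (k + x) - wave m c (k - x)
      = 2 * Real.cos (2 * Real.pi * ((k : ℝ) - c) / m) * wave m 0 x := by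
  have h1 := wave_intCast m c (k + x.val)
  have h2 := wave_intCast m c (k - x.val)
  have h3 := wave_intCast m 0 (x.val : ℤ)
  simp only [Int.cast_add, Int.cast_sub, Int.cast_natCast, ZMod.natCast_zmod_val] at h1 h2 h3
  rw [h1, h2, h3, Real.sin_sub_sin]
  rw [show (2 * Real.pi * ((k : ℝ) + x.val - c) / m - 2 * Real.pi * ((k : ℝ) - x.val - c) / m) / 2
      = 2 * Real.pi * ((x.val : ℝ) - 0) / m by ring,
    show (2 * Real.pi * ((k : ℝ) + x.val - c) / m + 2 * Real.pi * ((k : ℝ) - x.val - c) / m) / 2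
      = 2 * Real.pi * ((k : ℝ) - c) / m by ring]
  ring

variable {κ : Type*} [Fintype κ] [DecidableEq κ]

/-- A box of side lengths `n` with corner `a` in a product of cyclic groups. -/
def cyclicBox (m n : κ → ℕ) (a : κ → ℤ) : Finset ((i : κ) → ZMod (m i)) :=
  Fintype.piFinset fun i => (Finset.range (n i)).image fun t : ℕ => ((a i + t : ℤ) : ZMod (m i))

theorem mem_cyclicBox {m n : κ → ℕ} {a : κ → ℤ} {q : (i : κ) → ZMod (m i)} :
    q ∈ cyclicBox m n a ↔ ∀ i, ∃ t < n i, ((a i + t : ℤ) : ZMod (m i)) = q i := by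
  simp [cyclicBox, Fintype.mem_piFinset]

theorem card_cyclicBox_le (m n : κ → ℕ) (a : κ → ℤ) :
    (cyclicBox m n a).card ≤ ∏ i, n i := by
  rw [cyclicBox, Fintype.card_piFinset]
  exact Finset.prod_le_prod' fun i _ => Finset.card_image_le.trans (Finset.card_range _).le

/-- With c the centre of the interval, the distance to c is at most (n-1)/2 ≤ (m-1)/4, less than a
quarter period. -/
theorem cos_pos_of_box {m n : ℕ} (hm : 2 * n ≤ m + 1) (a : ℤ) (t : ℕ) (ht : t < n) :
    0 < Real.cos (2 * Real.pi * (((a + t : ℤ) : ℝ) - (a + ((n : ℝ) - 1) / 2)) / m) := by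
  have hm0 : (0 : ℝ) < m := by
    have : 0 < m := by omega
    exact_mod_cast this
  have hm' : 2 * (n : ℝ) ≤ m + 1 := by exact_mod_cast hm
  have ht' : (t : ℝ) + 1 ≤ n := by exact_mod_cast ht
  have ht0 : (0 : ℝ) ≤ t := Nat.cast_nonneg t
  apply Real.cos_pos_of_mem_Ioo
  push_cast
  constructor
  · rw [lt_div_iff₀ hm0]
    nlinarith [Real.pi_pos]
  · rw [div_lt_iff₀ hm0]
    nlinarith [Real.pi_pos]

/-- A symmetric set of shifts contains a half on which the shifts move every point of a short
box upwards in a suitable order. -/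
theorem exists_orientation [LinearOrder κ] (m n : κ → ℕ) [∀ i, NeZero (m i)] (a : κ → ℤ)
    (hmn : ∀ i, 2 * n i ≤ m i + 1) (R : Finset ((i : κ) → ZMod (m i)))
    (hR : ∀ u ∈ R, -u ∈ R) :
    ∃ (v : ((i : κ) → ZMod (m i)) → Lex (κ → ℝ)) (P : Finset ((i : κ) → ZMod (m i))), P ⊆ R ∧
      (∀ u ∈ P, ∀ j ∈ cyclicBox m n a, u + u = 0 ∨ v (j - u) < v (j + u)) ∧
      R.card ≤ 2 * P.card := by
  classical
  let τ : ((i : κ) → ZMod (m i)) → Lex (κ → ℝ) := fun u => toLex fun i => wave (m i) 0 (u i)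
  have hτ : ∀ u, τ (-u) = -τ u := by
    intro u
    change toLex _ = toLex _
    congr 1
    funext i
    exact wave_neg (m i) (u i)
  -- Each coordinate of v(j+u) - v(j-u) is a positive multiple of that of τ(u), so lexicographic
  -- order gives one answer for the whole box; since τ is odd, its nonnegative part meets every pair
  -- ±u.
  refine ⟨fun q => toLex fun i => wave (m i) (a i + ((n i : ℝ) - 1) / 2) (q i),
    R.filter fun u => 0 ≤ τ u, Finset.filter_subset _ _, ?_, ?_⟩
  · intro u hu j hj
    rcases (Finset.mem_filter.1 hu).2.eq_or_lt with h | h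
    · left
      funext i
      exact add_self_eq_zero_of_wave (m i) (u i) (congrFun (congrArg ofLex h.symm) i)
    · right
      have hdiff : ∀ i, ∃ r : ℝ, 0 < r ∧
          wave (m i) (a i + ((n i : ℝ) - 1) / 2) ((j + u) i)
            - wave (m i) (a i + ((n i : ℝ) - 1) / 2) ((j - u) i) = r * wave (m i) 0 (u i) := by
        intro i
        obtain ⟨t, ht, hji⟩ := mem_cyclicBox.1 hj i
        refine ⟨_, mul_pos two_pos (cos_pos_of_box (hmn i) (a i) t ht), ?_⟩
        rw [Pi.add_apply, Pi.sub_apply, ← hji, wave_add_sub_wave_sub]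
      obtain ⟨i, hlt, hi⟩ := h
      refine ⟨i, fun k hk => ?_, ?_⟩
      · obtain ⟨r, -, hr⟩ := hdiff k
        have h0 : wave (m k) 0 (u k) = 0 := (hlt k hk).symm
        rw [h0, mul_zero] at hr
        exact (sub_eq_zero.1 hr).symm
      · obtain ⟨r, hr0, hr⟩ := hdiff i
        have h0 : 0 < wave (m i) 0 (u i) := hi
        have := mul_pos hr0 h0
        rw [← hr] at this
        exact sub_pos.1 this
  · set P := R.filter fun u => 0 ≤ τ u
    have hsub : R ⊆ P ∪ P.image fun u => -u := by
      intro u hu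
      rcases le_or_gt 0 (τ u) with h | h
      · exact Finset.mem_union_left _ (Finset.mem_filter.2 ⟨hu, h⟩)
      · refine Finset.mem_union_right _ (Finset.mem_image.2 ⟨-u, ?_, neg_neg u⟩)
        refine Finset.mem_filter.2 ⟨hR u hu, ?_⟩
        rw [hτ]
        exact (neg_pos.2 h).le
    have h1 := (Finset.card_le_card hsub).trans (Finset.card_union_le _ _)
    have h2 : (P.image fun u => -u).card ≤ P.card := Finset.card_image_le
    omega

/-- In a box of a product of cyclic groups that is at most half as large, with a margin, there is
a background whose correlations at the shifts separating the box from itself determine every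
sample supported on the box. -/
theorem exists_background_box [LinearOrder κ] (m n : κ → ℕ) [∀ i, NeZero (m i)] (a : κ → ℤ)
    (hn : ∀ i, 0 < n i) (h : 2 * ∏ i, n i + ∏ i, (2 * n i - 1) ≤ ∏ i, m i) :
    ∃ Y : ((i : κ) → ZMod (m i)) → ℂ, ∀ D : ((i : κ) → ZMod (m i)) → ℂ,
      (∀ p, D p ≠ 0 → p ∈ cyclicBox m n a) →
      (∀ s, (∀ j ∈ cyclicBox m n a, j + s ∉ cyclicBox m n a ∧ j - s ∉ cyclicBox m n a) →
        symCorr Y D s = 0) → D = 0 := by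
  classical
  -- The coordinates in which the difference set of the box may fill the whole cycle. In the others
  -- 2n ≤ m + 1, as the orientation requires.
  let p : κ → Prop := fun i => m i < 2 * n i - 1
  let e := Equiv.piEquivPiSubtypeProd p fun i => ZMod (m i)
  let Ω' := cyclicBox (fun i : {i // p i} => m i) (fun i => n i) (fun i => a i)
  let Ω := cyclicBox (fun i : {i // ¬p i} => m i) (fun i => n i) (fun i => a i)
  -- The difference set of `Ω`: a shift whose second component avoids it separates the full box,
  -- whatever its component in the wrapping directions.
  let B := cyclicBox (fun i : {i // ¬p i} => m i) (fun i => 2 * n i - 1) (fun i => 1 - n i)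
  have hBneg : ∀ u, u ∈ B → -u ∈ B := by
    intro u hu
    rw [mem_cyclicBox] at hu ⊢
    intro i
    obtain ⟨t, ht, hi⟩ := hu i
    have := hn i
    refine ⟨2 * n i - 2 - t, by omega, ?_⟩
    rw [Pi.neg_apply, ← hi, ← Int.cast_neg]
    congr 1
    omega
  have hR : ∀ u ∈ Bᶜ, -u ∈ Bᶜ := by
    intro u hu
    rw [Finset.mem_compl] at hu ⊢
    intro h1
    exact hu (by simpa using hBneg _ h1)
  have hΩB : ∀ j ∈ Ω, ∀ j' ∈ Ω, j - j' ∈ B := by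
    intro j hj j' hj'
    rw [mem_cyclicBox] at hj hj' ⊢
    intro i
    obtain ⟨t, ht, hi⟩ := hj i
    obtain ⟨t', ht', hi'⟩ := hj' i
    refine ⟨n i - 1 + t - t', by omega, ?_⟩
    rw [Pi.sub_apply, ← hi, ← hi', ← Int.cast_sub]
    congr 1
    omega
  obtain ⟨v, P, hPR, hP, hRP⟩ := exists_orientation (fun i : {i // ¬p i} => m i)
    (fun i => n i) (fun i => a i) (fun i => by have := i.2; simp only [p] at this; omega) Bᶜ hR
  have hcard : 2 * (Ω'.card * Ω.card)
      ≤ Fintype.card ((i : {i // p i}) → ZMod (m i)) * (Bᶜ).card := by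
    have c1 : Ω'.card ≤ ∏ i : {i // p i}, n i := card_cyclicBox_le _ _ _
    have c2 : Ω.card ≤ ∏ i : {i // ¬p i}, n i := card_cyclicBox_le _ _ _
    have c3 : B.card ≤ ∏ i : {i // ¬p i}, (2 * n i - 1) := card_cyclicBox_le _ _ _
    have c4 : Fintype.card ((i : {i // p i}) → ZMod (m i)) = ∏ i : {i // p i}, m i := by
      rw [Fintype.card_pi]
      exact Finset.prod_congr rfl fun i _ => ZMod.card _
    have c5 : Fintype.card ((i : {i // ¬p i}) → ZMod (m i)) = ∏ i : {i // ¬p i}, m i := by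
      rw [Fintype.card_pi]
      exact Finset.prod_congr rfl fun i _ => ZMod.card _
    -- Wrapping directions lose at most mᵢ < 2nᵢ - 1 shifts each, so the count survives restricting
    -- the exclusion to the other directions.
    have c6 : ∏ i : {i // p i}, m i ≤ ∏ i : {i // p i}, (2 * n i - 1) :=
      Finset.prod_le_prod' fun i _ => i.2.le
    rw [Finset.card_compl, c4, c5]
    rw [← Fintype.prod_subtype_mul_prod_subtype p n,
      ← Fintype.prod_subtype_mul_prod_subtype p m,
      ← Fintype.prod_subtype_mul_prod_subtype p fun i => 2 * n i - 1] at h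
    rw [Nat.mul_sub]
    have d1 := Nat.mul_le_mul c1 c2
    have d2 := Nat.mul_le_mul c6 c3
    omega
  obtain ⟨Y, hY⟩ := exists_background_prod Ω' Ω Bᶜ P v hPR hP hRP hcard
  have hmem : ∀ q, q ∈ cyclicBox m n a ↔ (e q).1 ∈ Ω' ∧ (e q).2 ∈ Ω := by
    intro q
    simp only [Ω', Ω, mem_cyclicBox, e, Equiv.piEquivPiSubtypeProd_apply, Subtype.forall]
    constructor
    · intro hq
      exact ⟨fun i _ => hq i, fun i _ => hq i⟩
    · rintro ⟨h1, h2⟩ i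
      by_cases hi : p i
      · exact h1 i hi
      · exact h2 i hi
  refine ⟨fun q => Y (e q), fun D hD hs => ?_⟩
  have := hY (fun q => D (e.symm q)) (fun q hq => by
    simpa using (hmem _).1 (hD _ hq)) (fun s hs' => by
    have h0 := hs (e.symm s) (fun j hj => by
      have hjΩ := ((hmem j).1 hj).2
      rw [Finset.mem_compl] at hs'
      constructor
      · intro hc
        refine hs' ?_
        have h1 := hΩB _ ((hmem _).1 hc).2 _ hjΩ
        have h2 : (e (j + e.symm s)).2 - (e j).2 = (e (e.symm s)).2 := by
          funext i
          exact add_sub_cancel_left _ _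
        rwa [h2, Equiv.apply_symm_apply] at h1
      · intro hc
        refine hs' ?_
        have h1 := hΩB _ hjΩ _ ((hmem _).1 hc).2
        have h2 : (e j).2 - (e (j - e.symm s)).2 = (e (e.symm s)).2 := by
          funext i
          exact sub_sub_cancel _ _
        rwa [h2, Equiv.apply_symm_apply] at h1)
    rw [← h0, symCorr, symCorr, ← Equiv.sum_comp e]
    refine Finset.sum_congr rfl fun q _ => ?_
    have h1 : e (q + e.symm s) = e q + s := by
      conv_rhs => rw [← e.apply_symm_apply s]
      rfl
    have h2 : e (q - e.symm s) = e q - s := by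
      conv_rhs => rw [← e.apply_symm_apply s]
      rfl
    rw [h1, h2, e.symm_apply_apply])
  funext q
  have h1 := congrFun this (e q)
  simpa using h1

end Orientation

/-! ### From one good background to almost every background -/

section Generic

theorem measurable_eval_ofReal {J : Type*} [Finite J] (p : MvPolynomial J ℂ) :
    MeasurableSet {y : J → ℝ | MvPolynomial.eval (fun j => (y j : ℂ)) p ≠ 0} := by
  have h : Continuous fun y : J → ℝ => MvPolynomial.eval (fun j => (y j : ℂ)) p :=
    p.continuous_eval.comp (continuous_pi fun j => Complex.continuous_ofReal.comp (continuous_apply j))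
  exact (isOpen_ne.preimage h).measurableSet

/-- A nonzero complex polynomial vanishes on a null set of real points for every product of
atomless probability measures. -/
theorem ae_pi_eval_ne_zero {n : ℕ} (ν : Fin n → Measure ℝ) [∀ i, IsProbabilityMeasure (ν i)]
    (hν : ∀ i, NullSingletonClass (ν i)) (p : MvPolynomial (Fin n) ℂ) (hp : p ≠ 0) :
    ∀ᵐ y ∂Measure.pi ν, MvPolynomial.eval (fun j => (y j : ℂ)) p ≠ 0 := by
  induction n with
  | zero =>
    refine Filter.Eventually.of_forall fun y h0 => hp ?_
    rw [MvPolynomial.eq_C_of_isEmpty p] at h0 ⊢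
    rw [MvPolynomial.eval_C] at h0
    rw [h0, MvPolynomial.C_0]
  | succ n ih =>
    have hmp := measurePreserving_piFinSuccAbove ν 0
    have hq : MvPolynomial.finSuccEquiv ℂ n p ≠ 0 := by
      rwa [Ne, EmbeddingLike.map_eq_zero_iff]
    have key : ∀ᵐ z ∂((ν 0).prod <| Measure.pi fun j => ν ((0 : Fin (n + 1)).succAbove j)),
        MvPolynomial.eval (fun j => (((MeasurableEquiv.piFinSuccAbove (fun _ => ℝ) 0).symm z j : ℝ) : ℂ))
          p ≠ 0 := by
      refine (Measure.ae_prod_iff_ae_ae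
        ((MeasurableEquiv.piFinSuccAbove (fun _ => ℝ) 0).symm.measurable
          (measurable_eval_ofReal p))).2 ?_
      -- The slice at x is the zero polynomial only if the constant x is a root of p, read as a
      -- nonzero univariate polynomial over a domain. Fubini and induction handle the remaining x.
      have hfin : {x : ℝ | Polynomial.eval (MvPolynomial.C (x : ℂ))
          (MvPolynomial.finSuccEquiv ℂ n p) = 0}.Finite := by
        refine Set.Finite.of_finite_image ((Polynomial.finite_setOfPred_isRoot hq).subset ?_)
          (f := fun x : ℝ => MvPolynomial.C (x : ℂ)) ?_
        · rintro _ ⟨x, hx, rfl⟩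
          exact hx
        · intro x _ x' _ h
          exact Complex.ofReal_injective (MvPolynomial.C_injective _ _ h)
      have := hν 0
      have hae : ∀ᵐ x ∂ν 0, x ∉ {x : ℝ | Polynomial.eval (MvPolynomial.C (x : ℂ))
          (MvPolynomial.finSuccEquiv ℂ n p) = 0} :=
        measure_eq_zero_iff_ae_notMem.1 (hfin.measure_zero _)
      filter_upwards [hae] with x hx
      filter_upwards [ih (fun j => ν ((0 : Fin (n + 1)).succAbove j)) (fun j => hν _) _ hx] with y hy
      rw [MvPolynomial.eval_polynomial_eval_finSuccEquiv, MvPolynomial.eval_C] at hy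
      convert hy using 3
      funext j
      refine Fin.cases ?_ (fun j => ?_) j <;>
        simp [MeasurableEquiv.piFinSuccAbove, Fin.insertNthEquiv]
    have := hmp.quasiMeasurePreserving.ae key
    filter_upwards [this] with y hy
    simpa using hy

variable {W : Type*} [MeasurableSpace W] {P : Measure W} [IsProbabilityMeasure P]

/-- A nonzero polynomial in independent atomless random variables almost surely does not
vanish. -/
theorem ae_eval_ne_zero {J : Type*} [Fintype J] (X : J → W → ℝ)
    (hX : ∀ j, AEMeasurable (X j) P) (hν : ∀ j, NullSingletonClass (P.map (X j)))
    (hind : iIndepFun X P) (p : MvPolynomial J ℂ) (hp : p ≠ 0) :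
    ∀ᵐ w ∂P, MvPolynomial.eval (fun j => (X j w : ℂ)) p ≠ 0 := by
  let e := Fintype.equivFin J
  have hind' := hind.precomp e.symm.injective
  rw [iIndepFun_iff_map_fun_eq_pi_map fun i => hX _] at hind'
  have hpr : ∀ i, IsProbabilityMeasure (P.map (X (e.symm i))) := fun i =>
    Measure.isProbabilityMeasure_map (hX _)
  have h1 := ae_pi_eval_ne_zero (fun i => P.map (X (e.symm i))) (fun i => hν _)
    (MvPolynomial.rename e p)
    (by rwa [Ne, MvPolynomial.rename_eq_zero_iff_of_injective _ e.injective])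
  rw [← hind'] at h1
  have h2 := ae_of_ae_map (aemeasurable_pi_lambda _ fun i => hX _) h1
  filter_upwards [h2] with w hw
  rw [MvPolynomial.eval_rename] at hw
  convert hw using 3
  funext j
  simp [e]

variable {G : Type*} [AddCommGroup G] [Fintype G]

/-- The shifts moving the region `Ω` off itself in both directions. -/
def separatingShifts (Ω : Finset G) : Set G := {s | ∀ j ∈ Ω, j + s ∉ Ω ∧ j - s ∉ Ω}

/-- If one background determines all samples, then so does every background outside the zero set
of some nonzero polynomial in the entries off the region. -/
theorem exists_polynomial_of_background (Ω : Finset G) (Y₀ : G → ℂ)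
    (h₀ : ∀ D : G → ℂ, (∀ p, D p ≠ 0 → p ∈ Ω) →
      (∀ s ∈ separatingShifts Ω, symCorr Y₀ D s = 0) → D = 0) :
    ∃ q : MvPolynomial {x // x ∉ Ω} ℂ, q ≠ 0 ∧ ∀ Y : G → ℂ,
      MvPolynomial.eval (fun x => Y x.1) q ≠ 0 → ∀ D : G → ℂ, (∀ p, D p ≠ 0 → p ∈ Ω) →
      (∀ s ∈ separatingShifts Ω, symCorr Y D s = 0) → D = 0 := by
  classical
  let X : G → MvPolynomial {x // x ∉ Ω} ℂ := fun x =>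
    if h : x ∉ Ω then MvPolynomial.X ⟨x, h⟩ else 0
  have hX : ∀ (Y : G → ℂ) x, x ∉ Ω → MvPolynomial.eval (fun x => Y x.1) (X x) = Y x := by
    intro Y x hx
    simp [X, hx]
  let N : Matrix G Ω (MvPolynomial {x // x ∉ Ω} ℂ) := Matrix.of fun s p =>
    if s ∈ separatingShifts Ω then X (p + s) + X (p - s) else 0
  let M : (G → ℂ) → Matrix G Ω ℂ := fun Y => Matrix.of fun s p =>
    if s ∈ separatingShifts Ω then Y (p + s) + Y (p - s) else 0
  have hM : ∀ Y : G → ℂ, N.map (MvPolynomial.eval fun x => Y x.1) = M Y := by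
    intro Y
    ext s p
    simp only [Matrix.map_apply, Matrix.of_apply, N, M]
    split_ifs with hs
    · rw [map_add, hX _ _ (hs p p.2).1, hX _ _ (hs p p.2).2]
    · exact map_zero _
  have hMv : ∀ (Y D : G → ℂ), (∀ p, D p ≠ 0 → p ∈ Ω) → ∀ s ∈ separatingShifts Ω,
      (M Y).mulVec (fun p => D p) s = symCorr Y D s := by
    intro Y D hD s hs
    simp only [Matrix.mulVec, dotProduct, Matrix.of_apply, M, hs, if_true, symCorr]
    rw [Finset.sum_coe_sort Ω fun p => (Y (p + s) + Y (p - s)) * D p]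
    rw [Finset.sum_subset (Finset.subset_univ Ω) fun p _ hp => by
      rw [by_contra fun h => hp (hD p h), mul_zero]]
    exact Finset.sum_congr rfl fun p _ => mul_comm _ _
  have hMv' : ∀ (Y : G → ℂ) v, ∀ s ∉ separatingShifts Ω, (M Y).mulVec v s = 0 := by
    intro Y v s hs
    simp [Matrix.mulVec, dotProduct, M, hs]
  have hinj : Function.Injective (Matrix.toLin' (M Y₀)) := by
    rw [injective_iff_map_eq_zero]
    intro v hv
    let D : G → ℂ := fun p => if h : p ∈ Ω then v ⟨p, h⟩ else 0
    have hD : ∀ p, D p ≠ 0 → p ∈ Ω := fun p hp => by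
      by_contra hc
      exact hp (by simp [D, hc])
    have hDv : (fun p : Ω => D p) = v := by
      funext p
      simp [D]
    have hD0 := h₀ D hD fun s hs => by
      rw [← hMv Y₀ D hD s hs, hDv]
      exact congrFun hv s
    rw [← hDv, hD0]
    rfl
  -- A fixed left inverse at Y₀ makes the system square: det(g · M(Y)) is polynomial in Y, equals 1
  -- at Y₀, and certifies injectivity wherever it is nonzero.
  obtain ⟨g, hg⟩ := (Matrix.toLin' (M Y₀)).exists_leftInverse_of_injective
    (LinearMap.ker_eq_bot.2 hinj)
  have hgM : LinearMap.toMatrix' g * M Y₀ = 1 := by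
    rw [← LinearMap.toMatrix'_toLin' (M Y₀), ← LinearMap.toMatrix'_comp, hg,
      LinearMap.toMatrix'_id]
  let Q : Matrix Ω Ω (MvPolynomial {x // x ∉ Ω} ℂ) :=
    (LinearMap.toMatrix' g).map MvPolynomial.C * N
  let q := Q.det
  have hq : ∀ Y : G → ℂ, MvPolynomial.eval (fun x => Y x.1) q
      = (LinearMap.toMatrix' g * M Y).det := by
    intro Y
    let ev : MvPolynomial {x // x ∉ Ω} ℂ →+* ℂ := MvPolynomial.eval fun x => Y x.1
    have h1 : Q.map ev = ((LinearMap.toMatrix' g).map MvPolynomial.C).map ev * N.map ev :=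
      Matrix.map_mul
    have h2 : ((LinearMap.toMatrix' g).map MvPolynomial.C).map ev = LinearMap.toMatrix' g := by
      ext i j
      simp [ev]
    change ev q = _
    rw [RingHom.map_det, RingHom.mapMatrix_apply, h1, h2, hM]
  refine ⟨q, ?_, fun Y hY D hD hs => ?_⟩
  · intro h
    have := hq Y₀
    rw [h, hgM, map_zero, Matrix.det_one] at this
    exact zero_ne_one this
  · rw [hq] at hY
    have hv : (M Y).mulVec (fun p : Ω => D p) = 0 := by
      funext s
      by_cases h : s ∈ separatingShifts Ω
      · rw [hMv Y D hD s h, hs s h]; rfl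
      · rw [hMv' Y _ s h]; rfl
    have h0 := Matrix.eq_zero_of_mulVec_eq_zero hY (v := fun p : Ω => D p) (by
      rw [← Matrix.mulVec_mulVec, hv, Matrix.mulVec_zero])
    funext p
    by_cases hp : p ∈ Ω
    · exact congrFun h0 ⟨p, hp⟩
    · exact by_contra fun h => hp (hD p h)

/-- A random background with independent atomless entries off the region almost surely determines
every real sample, provided that some complex background determines every complex sample. -/
theorem ae_background_determines (Ω : Finset G) (Y : W → G → ℝ)
    (hY : ∀ x ∉ Ω, AEMeasurable (fun w => Y w x) P)
    (hν : ∀ x ∉ Ω, NullSingletonClass (P.map fun w => Y w x))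
    (hind : iIndepFun (fun (x : {x // x ∉ Ω}) w => Y w x.1) P) (Y₀ : G → ℂ)
    (h₀ : ∀ D : G → ℂ, (∀ p, D p ≠ 0 → p ∈ Ω) →
      (∀ s ∈ separatingShifts Ω, symCorr Y₀ D s = 0) → D = 0) :
    ∀ᵐ w ∂P, ∀ D : G → ℝ, (∀ p, D p ≠ 0 → p ∈ Ω) →
      (∀ s ∈ separatingShifts Ω, symCorr (Y w) D s = 0) → D = 0 := by
  classical
  obtain ⟨q, hq0, hq⟩ := exists_polynomial_of_background Ω Y₀ h₀
  filter_upwards [ae_eval_ne_zero _ (fun x => hY x.1 x.2) (fun x => hν x.1 x.2) hind q hq0]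
    with w hw D hD hs
  have := hq (fun x => (Y w x : ℂ)) hw (fun x => (D x : ℂ)) (fun p hp => hD p fun h => hp (by
    rw [h, Complex.ofReal_zero])) (fun s hs' => by
    have h1 := congrArg (fun r : ℝ => (r : ℂ)) (hs s hs')
    simpa [symCorr] using h1)
  funext p
  exact Complex.ofReal_injective (congrFun this p)

end Generic

/-! ### Fourier magnitudes, autocorrelations and array indices -/

section Autocorrelation

variable {d : ℕ} (m : Fin d → ℕ) [∀ i, NeZero (m i)]

/-- The Fourier kernel on a product of cyclic groups, as a character of the frequency. -/
noncomputable def fourierKernel (x : (i : Fin d) → ZMod (m i)) :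
    AddChar ((i : Fin d) → ZMod (m i)) ℂ where
  toFun l := ∏ i, ZMod.stdAddChar (-(x i * l i))
  map_zero_eq_one' := by simp
  map_add_eq_mul' l l' := by
    rw [← Finset.prod_mul_distrib]
    refine Finset.prod_congr rfl fun i _ => ?_
    rw [← AddChar.map_add_eq_mul, Pi.add_apply]
    congr 1
    ring

theorem fourierKernel_apply (x l : (i : Fin d) → ZMod (m i)) :
    fourierKernel m x l = ∏ i, ZMod.stdAddChar (-(x i * l i)) := rfl

theorem fourierKernel_sub (x y l : (i : Fin d) → ZMod (m i)) :
    fourierKernel m (x - y) l = fourierKernel m x l * starRingEnd ℂ (fourierKernel m y l) := by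
  simp only [fourierKernel_apply, map_prod]
  rw [← Finset.prod_mul_distrib]
  refine Finset.prod_congr rfl fun i _ => ?_
  rw [← AddChar.map_neg_eq_conj, ← AddChar.map_add_eq_mul, Pi.sub_apply]
  congr 1
  ring

theorem fourierKernel_injective : Function.Injective (fourierKernel m) := by
  intro x y h
  funext i
  have h1 := DFunLike.congr_fun h (Pi.single i 1)
  have h2 : ∀ z : (i : Fin d) → ZMod (m i),
      fourierKernel m z (Pi.single i 1) = ZMod.stdAddChar (-(z i)) := by
    intro z
    rw [fourierKernel_apply, Finset.prod_eq_single i]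
    · simp
    · intro j _ hj
      simp [hj]
    · simp
  rw [h2, h2] at h1
  exact neg_injective (ZMod.injective_stdAddChar h1)

/-- Fourier magnitudes determine the cyclic autocorrelation. -/
theorem autocorrelation_eq_of_norm_eq (z z' : ((i : Fin d) → ZMod (m i)) → ℝ)
    (h : ∀ l, ‖∑ x, (z x : ℂ) * fourierKernel m x l‖ ^ 2
      = ‖∑ x, (z' x : ℂ) * fourierKernel m x l‖ ^ 2) (s : (i : Fin d) → ZMod (m i)) :
    ∑ y, z y * z (y + s) = ∑ y, z' y * z' (y + s) := by
  have key : ∀ (z : ((i : Fin d) → ZMod (m i)) → ℝ) l,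
      ((‖∑ x, (z x : ℂ) * fourierKernel m x l‖ ^ 2 : ℝ) : ℂ)
        = ∑ s, ((∑ y, z y * z (y + s) : ℝ) : ℂ) * fourierKernel m s l := by
    intro z l
    push_cast
    rw [← Complex.mul_conj', map_sum, Finset.sum_mul_sum, Finset.sum_comm]
    simp_rw [Finset.sum_mul]
    rw [Finset.sum_comm (s := Finset.univ) (t := Finset.univ)
      (f := fun s y => (z y : ℂ) * (z (y + s) : ℂ) * fourierKernel m s l)]
    refine Finset.sum_congr rfl fun y _ => ?_
    symm
    rw [← Equiv.sum_comp (Equiv.subRight y)]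
    refine Finset.sum_congr rfl fun x _ => ?_
    rw [Equiv.subRight_apply, fourierKernel_sub, add_sub_cancel, map_mul, Complex.conj_ofReal]
    ring
  -- The squared magnitude is the autocorrelation expanded in distinct characters of the frequency,
  -- so their independence recovers its coefficients.
  have hli := (AddChar.linearIndependent ((i : Fin d) → ZMod (m i)) ℂ).comp (fourierKernel m)
    (fourierKernel_injective m)
  have h0 := Fintype.linearIndependent_iff.1 hli
    (fun s => ((∑ y, z y * z (y + s) : ℝ) : ℂ) - ((∑ y, z' y * z' (y + s) : ℝ) : ℂ)) (by
      funext l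
      have h1 := congrArg (fun r : ℝ => (r : ℂ)) (h l)
      simp only [key] at h1
      simp only [Function.comp_apply, Finset.sum_apply, Pi.smul_apply, smul_eq_mul, sub_mul,
        Finset.sum_sub_distrib, h1, sub_self, Pi.zero_apply]) s
  exact Complex.ofReal_injective (sub_eq_zero.1 h0)

/-- A polarisation identity: after translating one of the two sums, the cross terms in z and z'
cancel and twice the difference of the autocorrelations remains. -/
theorem symCorr_add_sub {G : Type*} [AddCommGroup G] [Fintype G] (z z' : G → ℝ) (s : G)
    (h : ∑ y, z y * z (y + s) = ∑ y, z' y * z' (y + s)) :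
    symCorr (fun x => z x + z' x) (fun x => z' x - z x) s = 0 := by
  have h1 : ∑ p, (z' p - z p) * (z (p - s) + z' (p - s))
      = ∑ p, (z' (p + s) - z (p + s)) * (z p + z' p) := by
    rw [← Equiv.sum_comp (Equiv.addRight s)]
    simp
  simp only [symCorr, mul_add (z' _ - z _) (z _ + z' _), Finset.sum_add_distrib]
  rw [h1, ← Finset.sum_add_distrib]
  calc _ = ∑ p, (2 * (z' p * z' (p + s)) - 2 * (z p * z (p + s))) :=
        Finset.sum_congr rfl fun p _ => by ring
    _ = 0 := by
      rw [Finset.sum_sub_distrib, ← Finset.mul_sum, ← Finset.mul_sum, h, sub_self]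

/-- Array indices as elements of the product of cyclic groups. -/
def idxEquiv : Idx m ≃ ((i : Fin d) → ZMod (m i)) where
  toFun j i := ((j i : ℕ) : ZMod (m i))
  invFun x i := ⟨(x i).val, ZMod.val_lt _⟩
  left_inv j := by
    funext i
    exact Fin.ext (ZMod.val_cast_of_lt (j i).2)
  right_inv x := by
    funext i
    exact ZMod.natCast_zmod_val _

theorem dft_eq_sum_fourierKernel (Z : Idx m → ℝ) (l : Idx m) :
    dft m Z l = ∑ x, (Z ((idxEquiv m).symm x) : ℂ) * fourierKernel m x (idxEquiv m l) := by
  rw [← Equiv.sum_comp (idxEquiv m)]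
  refine Finset.sum_congr rfl fun j _ => ?_
  rw [Equiv.symm_apply_apply, fourierKernel_apply, Finset.mul_sum, Complex.exp_sum]
  congr 1
  refine Finset.prod_congr rfl fun i _ => ?_
  have : (-((idxEquiv m j) i * (idxEquiv m l) i) : ZMod (m i))
      = ((-((j i : ℕ) * (l i : ℕ) : ℤ) : ℤ) : ZMod (m i)) := by
    simp [idxEquiv]
  rw [this, ZMod.stdAddChar_coe]
  congr 1
  push_cast
  ring

theorem mem_region_iff (n a : Fin d → ℕ) (h : ∀ i, a i + n i ≤ m i) (j : Idx m) :
    j ∈ region m n a ↔ idxEquiv m j ∈ cyclicBox m n fun i => (a i : ℤ) := by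
  rw [mem_cyclicBox]
  refine forall_congr' fun i => ?_
  constructor
  · rintro ⟨h1, h2⟩
    refine ⟨(j i : ℕ) - a i, by omega, ?_⟩
    have : ((a i : ℤ) + (((j i : ℕ) - a i : ℕ) : ℤ)) = ((j i : ℕ) : ℤ) := by omega
    rw [this]
    simp [idxEquiv]
  · rintro ⟨t, ht, he⟩
    have hlt : a i + t < m i := lt_of_lt_of_le (Nat.add_lt_add_left ht _) (h i)
    have h1 : ((a i + t : ℕ) : ZMod (m i)) = ((j i : ℕ) : ZMod (m i)) := by
      have : ((a i + t : ℕ) : ZMod (m i)) = ((a i + t : ℤ) : ZMod (m i)) := by push_cast; rfl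
      rw [this, he]
      rfl
    rw [ZMod.natCast_eq_natCast_iff', Nat.mod_eq_of_lt hlt, Nat.mod_eq_of_lt (j i).2] at h1
    omega

end Autocorrelation

/-! ### Uniqueness for the phase retrieval problem -/

/-- If the only sample invisible to the correlations at separating shifts is zero, then the phase
retrieval problem with background `Y` has at most one solution for every data. -/
theorem eq_of_intensity_eq {d : ℕ} (m n a : Fin d → ℕ) [∀ i, NeZero (m i)]
    (h : ∀ i, a i + n i ≤ m i) (Y : Idx m → ℝ)
    (hY : ∀ D : ((i : Fin d) → ZMod (m i)) → ℝ,
      (∀ p, D p ≠ 0 → p ∈ cyclicBox m n fun i => (a i : ℤ)) →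
      (∀ s ∈ separatingShifts (cyclicBox m n fun i => (a i : ℤ)),
        symCorr (fun x => Y ((idxEquiv m).symm x)) D s = 0) → D = 0)
    (X X' : Idx n → ℝ)
    (hI : intensity m (combine m n a X Y) = intensity m (combine m n a X' Y)) :
    combine m n a X Y = combine m n a X' Y := by
  set z : ((i : Fin d) → ZMod (m i)) → ℝ :=
    fun x => combine m n a X Y ((idxEquiv m).symm x) with hz
  set z' : ((i : Fin d) → ZMod (m i)) → ℝ :=
    fun x => combine m n a X' Y ((idxEquiv m).symm x) with hz'
  set B := cyclicBox m n fun i => (a i : ℤ) with hB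
  have hoff : ∀ X : Idx n → ℝ, ∀ x ∉ B, combine m n a X Y ((idxEquiv m).symm x)
      = Y ((idxEquiv m).symm x) := by
    intro X x hx
    have : (idxEquiv m).symm x ∉ region m n a := by
      rw [mem_region_iff m n a h, Equiv.apply_symm_apply]
      exact hx
    rw [combine, dif_neg this]
  have hauto := autocorrelation_eq_of_norm_eq m z z' fun l => by
    have h1 := congrFun hI ((idxEquiv m).symm l)
    simpa only [intensity, dft_eq_sum_fourierKernel, Equiv.apply_symm_apply] using h1
  have hD := hY (fun x => z' x - z x) (fun p hp => by
    by_contra hc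
    exact hp (by simp only [hz, hz', hoff _ p hc, sub_self])) (fun s hs => by
    have h1 := symCorr_add_sub z z' s (hauto s)
    -- The linearisation: wherever the difference is nonzero, both shifted points lie off the box,
    -- where z and z' equal the known background.
    have h2 : symCorr (fun x => z x + z' x) (fun x => z' x - z x) s
        = 2 * symCorr (fun x => Y ((idxEquiv m).symm x)) (fun x => z' x - z x) s := by
      simp only [symCorr, Finset.mul_sum]
      refine Finset.sum_congr rfl fun p _ => ?_
      by_cases hp : p ∈ B
      · simp only [hz, hz', hoff _ _ (hs p hp).1, hoff _ _ (hs p hp).2]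
        ring
      · simp only [hz, hz', hoff _ p hp, sub_self, zero_mul, mul_zero]
    rw [h2] at h1
    linarith)
  funext j
  have h1 := congrFun hD (idxEquiv m j)
  simp only [hz, hz', Equiv.symm_apply_apply, Pi.zero_apply] at h1
  exact (sub_eq_zero.1 h1).symm

/-- Almost sure uniqueness under the counting condition, in natural numbers. -/
theorem almostSurelyUnique_of_le {d : ℕ} {W : Type*} [MeasurableSpace W] (P : Measure W)
    [IsProbabilityMeasure P] (μ : ℝ) (σ : ℝ≥0) (hσ : 0 < σ) (m n a : Fin d → ℕ)
    (hn : ∀ i, 0 < n i) (ham : ∀ i, a i + n i ≤ m i) (Y : W → Idx m → ℝ)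
    (hY : IsGaussianBackground m n a P μ σ Y)
    (h : 2 * ∏ i, n i + ∏ i, (2 * n i - 1) ≤ ∏ i, m i) :
    AlmostSurelyUnique m n a P Y := by
  classical
  have hne : ∀ i, NeZero (m i) := fun i => ⟨by have := hn i; have := ham i; omega⟩
  obtain ⟨Y₀, hY₀⟩ := exists_background_box m n (fun i => (a i : ℤ)) hn h
  have hmem : ∀ x, x ∉ (cyclicBox m n fun i => (a i : ℤ)) →
      (idxEquiv m).symm x ∉ region m n a := by
    intro x hx
    rwa [mem_region_iff m n a ham, Equiv.apply_symm_apply]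
  have hind := hY.indep_off.precomp
    (g := fun x : {x // x ∉ cyclicBox m n fun i => (a i : ℤ)} =>
      (⟨(idxEquiv m).symm x.1, hmem x.1 x.2⟩ : {j : Idx m // j ∉ region m n a}))
    (fun x y hxy => Subtype.ext ((idxEquiv m).symm.injective (congrArg Subtype.val hxy)))
  have hae := ae_background_determines (P := P) (cyclicBox m n fun i => (a i : ℤ))
    (fun w x => Y w ((idxEquiv m).symm x))
    (fun x hx => (hY.law_off _ (hmem x hx)).aemeasurable)
    (fun x hx => by
      rw [(hY.law_off _ (hmem x hx)).map_eq]
      exact nullSingletonClass_gaussianReal (pow_ne_zero 2 hσ.ne'))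
    hind Y₀ hY₀
  filter_upwards [hae] with w hw X
  refine ⟨combine m n a X (Y w), ⟨rfl, X, rfl⟩, ?_⟩
  rintro _ ⟨hI, X', rfl⟩
  exact eq_of_intensity_eq m n a ham (Y w) hw X' X hI

end BackgroundPR

theorem lemma2p4 {d : ℕ} (hd : 0 < d) {W : Type*} [MeasurableSpace W]
    (P : MeasureTheory.Measure W) [MeasureTheory.IsProbabilityMeasure P]
    (μ : ℝ) (σ : NNReal) (hσ : 0 < σ)
    (n k a : Fin d → ℕ) (hn : ∀ i, 0 < n i) (ha : ∀ i, a i ≤ k i)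
    (Y : W → BackgroundPR.Idx (fun i => n i + k i) → ℝ)
    (hY : BackgroundPR.IsGaussianBackground (fun i => n i + k i) n a P μ σ Y) :
    ((2 * ∏ i, (n i : ℤ) + ∏ i, (2 * (n i : ℤ) - 1) ≤ ∏ i, ((n i : ℤ) + (k i : ℤ))) →
      BackgroundPR.AlmostSurelyUnique (fun i => n i + k i) n a P Y) ∧
    (∀ n₀ k₀ : ℕ, (∀ i, n i = n₀) → (∀ i, k i = k₀) →
      ((2 : ℝ) ^ (((d : ℝ) + 1) / (d : ℝ)) - 1) * (n₀ : ℝ) ≤ (k₀ : ℝ) →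
      BackgroundPR.AlmostSurelyUnique (fun i => n i + k i) n a P Y) := by
  constructor
  · intro h
    refine BackgroundPR.almostSurelyUnique_of_le P μ σ hσ _ n a hn
      (fun i => by have := ha i; omega) Y hY ?_
    have h1 : ∏ i, (2 * (n i : ℤ) - 1) = ∏ i, ((2 * n i - 1 : ℕ) : ℤ) :=
      Finset.prod_congr rfl fun i _ => by
        have := hn i
        omega
    rw [h1] at h
    exact_mod_cast h
  · intro n₀ k₀ hn₀ hk₀ h
    refine BackgroundPR.almostSurelyUnique_of_le P μ σ hσ _ n a hn
      (fun i => by have := ha i; omega) Y hY ?_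
    simp only [hn₀, hk₀, Finset.prod_const, Finset.card_univ, Fintype.card_fin]
    have hd' : (d : ℝ) ≠ 0 := Nat.cast_ne_zero.2 hd.ne'
    have h1 : (2 : ℝ) ^ (((d : ℝ) + 1) / (d : ℝ)) * n₀ ≤ n₀ + k₀ := by linarith
    -- The d-th power of the assumed bound gives 2^(d+1) n₀^d ≤ (n₀+k₀)^d. Half of the left side
    -- dominates (2n₀-1)^d and the other half 2n₀^d, the latter because d ≥ 1.
    have h2 : ((2 : ℝ) ^ (((d : ℝ) + 1) / (d : ℝ))) ^ d = 2 ^ (d + 1) := by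
      rw [← Real.rpow_natCast, ← Real.rpow_mul (by norm_num), div_mul_cancel₀ _ hd',
        ← Real.rpow_natCast]
      push_cast
      rfl
    have h3 := pow_le_pow_left₀ (by positivity) h1 d
    rw [mul_pow, h2] at h3
    have h4 : 2 ^ (d + 1) * n₀ ^ d ≤ (n₀ + k₀) ^ d := by exact_mod_cast h3
    have h5 : (2 * n₀ - 1) ^ d ≤ 2 ^ d * n₀ ^ d := by
      rw [← mul_pow]
      exact Nat.pow_le_pow_left (Nat.sub_le _ _) d
    have h6 : 2 * n₀ ^ d ≤ 2 ^ d * n₀ ^ d :=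
      Nat.mul_le_mul_right _ (le_self_pow₀ (by norm_num) hd.ne')
    calc 2 * n₀ ^ d + (2 * n₀ - 1) ^ d ≤ 2 ^ d * n₀ ^ d + 2 ^ d * n₀ ^ d := Nat.add_le_add h6 h5
      _ = 2 ^ (d + 1) * n₀ ^ d := by ring
      _ ≤ (n₀ + k₀) ^ d := h4
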